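/- Consider the interconnected system \[\dot z(t)=q(z(t),x(t),u(t)),\qquad \dot x(t)=f(z(t),x(t),u(t)),\] with $z\in\mathbb R^{p}$ (not measured), $x\in\mathbb R^{n}$, $u\in\mathbb R^{m}$, $q,f$ continuous, $q(0,0,0)=0$, $f(0,0,0)=0$, and a continuously differentiable feedback $g:\mathbb R^n\to\mathbb R^m$. For a signal $w$ write $\|w_{[a,b]}\|=\sup_{a\le s\le b}\|w(s)\|$. Suppose that, for every initial time $t_0$, every bounded piecewise continuous external input $r$ and every solution, on its interval of existence, of \[\dot z=q(z,x,g(x)-r),\qquad \dot x=f(z,x,g(x)-r),\] with output $\xi(t)=\frac{d}{dt}g(x(t))$ (derivative from the right where $r$ jumps), the following holds for all $t>t_0$: (i) $\|z(t)\|\le\max\{\beta_z(\|z(t_0)\|,t-t_0),\gamma_z^x(\|x_{[t_0,t]}\|),\gamma_z^r(\|r_{[t_0,t]}\|)\}$ and $\|x(t)\|\le\max\{\beta_x(\|x(t_0)\|,t-t_0),\gamma_x^z(\|z_{[t_0,t]}\|),\gamma_x^r(\|r_{[t_0,t]}\|)\}$, where $\beta_z,\beta_x\in\mathcal{KL}$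 and $\gamma_z^x,\gamma_z^r,\gamma_x^z,\gamma_x^r\in\mathcal K_\infty$; (ii) $\|\xi(t)\|\le\max\{\gamma_\xi^z(\|z_{[t_0,t]}\|),\gamma_\xi^x(\|x_{[t_0,t]}\|),\gamma_\xi^r(\|r_{[t_0,t]}\|)\}$, where $\gamma_\xi^z,\gamma_\xi^x,\gamma_\xi^r\in\mathcal K_\infty$. Suppose also that (iii) $\gamma_z^x\circ\gamma_x^z(s)<s$ for all $s>0$. Put $\bar\gamma_z^r=\max\{\gamma_z^r,\gamma_z^x\circ\gamma_x^r\}$, $\bar\gamma_x^r=\max\{\gamma_x^r,\gamma_x^z\circ\gamma_z^r\}$ and $\gamma=\max\{\gamma_\xi^z\circ\bar\gamma_z^r,\ \gamma_\xi^x\circ\bar\gamma_x^r,\ \gamma_\xi^r\}$, and suppose that $\lim_{s\to0^+}\gamma(s)/s$ exists and is finite. Let $\epsilon>1$ and let $\bar\gamma\in\mathcal K_\infty$ satisfy $\bar\gamma(s)\ge\epsilon\gamma(s)$ for all $s>0$ and $\lim_{s\to0^+}\bar\gamma(s)/s=C$ with $0<C<\infty$. Apply the sampled control $u(t)=g(x(t_k))$,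 $t\in[t_k,t_{k+1})$, $k=0,1,2,\dots$, with the sampling instants generated by \[t_{k+1}=\inf\{t>t_k:\ (t-t_k)\,\bar\gamma(\|r_{[t_k,t]}\|)\ge\|r_{[t_k,t]}\|\ \text{and}\ \|r_{[t_k,t]}\|\ne0\},\qquad r(t)=\int_{t_k}^{t}\xi(s)\,ds,\quad \xi(s)=\frac{d}{ds}g(x(s)),\] where $\inf\emptyset=\infty$ (no further sampling). Then the closed-loop system has a maximal solution from every initial state, every maximal solution is defined for all $t\ge t_0$, the origin $(z,x)=(0,0)$ is globally asymptotically stable (stable, and $(z(t),x(t))\to0$ along every maximal solution), and there is no Zeno behaviour: $\inf_k(t_{k+1}-t_k)>0$ along every maximal solution. -/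

import Mathlib

open Set Filter Topology MeasureTheory

noncomputable section

namespace EventTriggered

/-! ### Comparison functions (only their values on `[0, ∞)` matter) -/

/-- Class `K`. -/
structure IsClassK (α : ℝ → ℝ) : Prop where
  zero : α 0 = 0
  continuousOn : ContinuousOn α (Ici 0)
  strictMonoOn : StrictMonoOn α (Ici 0)

/-- Class `K_∞`. -/
structure IsClassKInf (α : ℝ → ℝ) : Prop extends IsClassK α where
  tendsto_atTop : Tendsto α atTop atTop

/-- Class `KL`: class `K` in the first argument, decreasing to zero in the second one. -/
structure IsClassKL (β : ℝ → ℝ → ℝ) : Prop where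
  classK : ∀ t, 0 ≤ t → IsClassK (fun s => β s t)
  antitoneOn : ∀ s, 0 ≤ s → AntitoneOn (β s) (Ici 0)
  tendsto_zero : ∀ s, 0 ≤ s → Tendsto (β s) atTop (𝓝 0)

/-! ### Signals -/

/-- `‖w_{[a,b]}‖`, the supremum of `‖w s‖` over `s ∈ [a, b]`. -/
def supNorm {E : Type*} [NormedAddCommGroup E] (w : ℝ → E) (a b : ℝ) : ℝ :=
  sSup ((fun s => ‖w s‖) '' Icc a b)

/-- `r` is a bounded piecewise continuous input on `[a, b)`: finitely many jumps, left limits,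
and the value at a jump is the limit from the right. -/
structure IsAdmissibleInput {E : Type*} [NormedAddCommGroup E] (r : ℝ → E) (a b : ℝ) : Prop where
  finite_jumps : ∃ S : Finset ℝ, ∀ t ∈ Ioo a b, t ∉ S → ContinuousAt r t
  right_continuous : ∀ t ∈ Ico a b, ContinuousWithinAt r (Ici t) t
  left_limit : ∀ t ∈ Ioo a b, ∃ l, Tendsto r (𝓝[<] t) (𝓝 l)
  bounded : ∃ M, ∀ t ∈ Ico a b, ‖r t‖ ≤ M

section System

variable {p n m : ℕ}

/-- The auxiliary output `ξ(t) = d g(x(t)) / dt`. The state `x` is piecewise `C¹`; at an instant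
where the input jumps this is the derivative from the right. -/
def auxOutput (g : EuclideanSpace ℝ (Fin n) → EuclideanSpace ℝ (Fin m))
    (x : ℝ → EuclideanSpace ℝ (Fin n)) (t : ℝ) : EuclideanSpace ℝ (Fin m) :=
  derivWithin (fun s => g (x s)) (Ici t) t

/-- The auxiliary input `r(t) = ∫_{t_k}^t ξ(s) ds` counted from the sampling instant `t_k`. -/
def auxInput (g : EuclideanSpace ℝ (Fin n) → EuclideanSpace ℝ (Fin m))
    (x : ℝ → EuclideanSpace ℝ (Fin n)) (tk t : ℝ) : EuclideanSpace ℝ (Fin m) :=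
  ∫ s in tk..t, auxOutput g x s

variable
  (q : EuclideanSpace ℝ (Fin p) × EuclideanSpace ℝ (Fin n) × EuclideanSpace ℝ (Fin m) →
    EuclideanSpace ℝ (Fin p))
  (f : EuclideanSpace ℝ (Fin p) × EuclideanSpace ℝ (Fin n) × EuclideanSpace ℝ (Fin m) →
    EuclideanSpace ℝ (Fin n))
  (g : EuclideanSpace ℝ (Fin n) → EuclideanSpace ℝ (Fin m))

/-! ### The closed loop with `r` as external input, and its stability properties -/

/-- `(z, x)` solves `ż = q(z, x, g(x) - r)`, `ẋ = f(z, x, g(x) - r)` on `[a, b)` for the external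
input `r`. For continuous data a continuous curve with these right derivatives is exactly a
solution that is `C¹` between the jumps of `r`. -/
structure IsPerturbedSolution (r : ℝ → EuclideanSpace ℝ (Fin m))
    (z : ℝ → EuclideanSpace ℝ (Fin p)) (x : ℝ → EuclideanSpace ℝ (Fin n)) (a b : ℝ) : Prop where
  input : IsAdmissibleInput r a b
  continuousOn_z : ContinuousOn z (Ico a b)
  continuousOn_x : ContinuousOn x (Ico a b)
  deriv_z : ∀ t ∈ Ico a b, HasDerivWithinAt z (q (z t, x t, g (x t) - r t)) (Ici t) t
  deriv_x : ∀ t ∈ Ico a b, HasDerivWithinAt x (f (z t, x t, g (x t) - r t)) (Ici t) t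

/-- ISS estimate for the `z`-dynamics of the perturbed closed loop. -/
def ISSz (βz : ℝ → ℝ → ℝ) (γzx γzr : ℝ → ℝ) : Prop :=
  ∀ (a b : ℝ) (r : ℝ → EuclideanSpace ℝ (Fin m)) (z : ℝ → EuclideanSpace ℝ (Fin p))
    (x : ℝ → EuclideanSpace ℝ (Fin n)), IsPerturbedSolution q f g r z x a b →
    ∀ t ∈ Ioo a b, ‖z t‖ ≤
      max (βz ‖z a‖ (t - a)) (max (γzx (supNorm x a t)) (γzr (supNorm r a t)))

/-- ISS estimate for the `x`-dynamics of the perturbed closed loop. -/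
def ISSx (βx : ℝ → ℝ → ℝ) (γxz γxr : ℝ → ℝ) : Prop :=
  ∀ (a b : ℝ) (r : ℝ → EuclideanSpace ℝ (Fin m)) (z : ℝ → EuclideanSpace ℝ (Fin p))
    (x : ℝ → EuclideanSpace ℝ (Fin n)), IsPerturbedSolution q f g r z x a b →
    ∀ t ∈ Ioo a b, ‖x t‖ ≤
      max (βx ‖x a‖ (t - a)) (max (γxz (supNorm z a t)) (γxr (supNorm r a t)))

/-- Bounded state and input to bounded output: the estimate for `ξ`. -/
def BSIBO (γξz γξx γξr : ℝ → ℝ) : Prop :=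
  ∀ (a b : ℝ) (r : ℝ → EuclideanSpace ℝ (Fin m)) (z : ℝ → EuclideanSpace ℝ (Fin p))
    (x : ℝ → EuclideanSpace ℝ (Fin n)), IsPerturbedSolution q f g r z x a b →
    ∀ t ∈ Ioo a b, ‖auxOutput g x t‖ ≤
      max (γξz (supNorm z a t)) (max (γξx (supNorm x a t)) (γξr (supNorm r a t)))

/-! ### Gains -/

/-- `γ̄_z^r = max {γ_z^r, γ_z^x ∘ γ_x^r}`. -/
def barGainZ (γzx γzr γxr : ℝ → ℝ) (s : ℝ) : ℝ := max (γzr s) (γzx (γxr s))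

/-- `γ̄_x^r = max {γ_x^r, γ_x^z ∘ γ_z^r}`. -/
def barGainX (γxz γxr γzr : ℝ → ℝ) (s : ℝ) : ℝ := max (γxr s) (γxz (γzr s))

/-- `γ = max {γ_ξ^z ∘ γ̄_z^r, γ_ξ^x ∘ γ̄_x^r, γ_ξ^r}`. -/
def compositeGain (γzx γzr γxz γxr γξz γξx γξr : ℝ → ℝ) (s : ℝ) : ℝ :=
  max (γξz (barGainZ γzx γzr γxr s)) (max (γξx (barGainX γxz γxr γzr s)) (γξr s))

/-! ### Event-triggered executions -/

/-- The triggering condition at time `t` after the sampling instant `tk`: with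
`ρ = ‖r_{[tk,t]}‖ ≠ 0`, the quantity `(t - tk) γ̄(ρ)` has reached `ρ`. -/
def Triggered (γbar : ℝ → ℝ) (x : ℝ → EuclideanSpace ℝ (Fin n)) (tk t : ℝ) : Prop :=
  supNorm (auxInput g x tk) tk t ≠ 0 ∧
    supNorm (auxInput g x tk) tk t ≤ (t - tk) * γbar (supNorm (auxInput g x tk) tk t)

/-- The sampling instant that follows `s` along a trajectory that lives on `[t₀, T)`:
the infimum of the triggering times, and `⊤` (no further sampling) if there are none. -/
def nextSample (γbar : ℝ → ℝ) (x : ℝ → EuclideanSpace ℝ (Fin n)) (T s : EReal) : EReal :=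
  sInf {σ : EReal | ∃ tk t : ℝ, s = (tk : EReal) ∧ σ = (t : EReal) ∧ tk < t ∧ (t : EReal) < T ∧
    Triggered g γbar x tk t}

/-- `(z, x)` is a trajectory on `[t₀, T)` of `ż = q(z, x, u)`, `ẋ = f(z, x, u)` with
`u(t) = g(x(t_k))` for `t ∈ [t_k, t_{k+1})` and the sampling instants `τ k = t_k` generated by the
event-triggering law; `t_k = ⊤` means that there are at most `k` sampling instants. A trajectory
does not continue beyond an accumulation point of sampling instants. -/
structure IsExecution (γbar : ℝ → ℝ) (t₀ : ℝ) (T : EReal) (τ : ℕ → EReal)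
    (z : ℝ → EuclideanSpace ℝ (Fin p)) (x : ℝ → EuclideanSpace ℝ (Fin n)) : Prop where
  start_lt : (t₀ : EReal) < T
  sample_zero : τ 0 = (t₀ : EReal)
  sample_succ : ∀ k, τ (k + 1) = nextSample g γbar x T (τ k)
  covered : T ≤ ⨆ k, τ k
  continuousOn_z : ContinuousOn z {t : ℝ | t₀ ≤ t ∧ (t : EReal) < T}
  continuousOn_x : ContinuousOn x {t : ℝ | t₀ ≤ t ∧ (t : EReal) < T}
  deriv_z : ∀ (k : ℕ) (tk t : ℝ), τ k = (tk : EReal) → tk ≤ t → (t : EReal) < τ (k + 1) →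
    (t : EReal) < T → HasDerivWithinAt z (q (z t, x t, g (x tk))) (Ici t) t
  deriv_x : ∀ (k : ℕ) (tk t : ℝ), τ k = (tk : EReal) → tk ≤ t → (t : EReal) < τ (k + 1) →
    (t : EReal) < T → HasDerivWithinAt x (f (z t, x t, g (x tk))) (Ici t) t

/-- An execution that is not the restriction of one with a longer life time. -/
def IsMaximalExecution (γbar : ℝ → ℝ) (t₀ : ℝ) (T : EReal) (τ : ℕ → EReal)
    (z : ℝ → EuclideanSpace ℝ (Fin p)) (x : ℝ → EuclideanSpace ℝ (Fin n)) : Prop :=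
  IsExecution q f g γbar t₀ T τ z x ∧
    ∀ (T' : EReal) (τ' : ℕ → EReal) (z' : ℝ → EuclideanSpace ℝ (Fin p))
      (x' : ℝ → EuclideanSpace ℝ (Fin n)), IsExecution q f g γbar t₀ T' τ' z' x' →
      (∀ t : ℝ, t₀ ≤ t → (t : EReal) < T → z' t = z t ∧ x' t = x t) → T' ≤ T

/-- Executions exist from every initial state, and the maximal ones never stop. -/
def IsComplete (γbar : ℝ → ℝ) : Prop :=
  (∀ (t₀ : ℝ) (z₀ : EuclideanSpace ℝ (Fin p)) (x₀ : EuclideanSpace ℝ (Fin n)),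
    ∃ T τ z x, IsMaximalExecution q f g γbar t₀ T τ z x ∧ z t₀ = z₀ ∧ x t₀ = x₀) ∧
  ∀ t₀ T τ z x, IsMaximalExecution q f g γbar t₀ T τ z x → T = ⊤

/-- Global asymptotic stability of the origin: stability and global attractivity
(the norm on the product is the maximum norm). -/
def IsGloballyAsymptoticallyStable (γbar : ℝ → ℝ) : Prop :=
  (∀ η > 0, ∃ δ > 0, ∀ t₀ T τ z x, IsMaximalExecution q f g γbar t₀ T τ z x →
    ‖(z t₀, x t₀)‖ ≤ δ → ∀ t : ℝ, t₀ ≤ t → (t : EReal) < T → ‖(z t, x t)‖ ≤ η) ∧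
  ∀ t₀ T τ z x, IsMaximalExecution q f g γbar t₀ T τ z x →
    T = ⊤ ∧ Tendsto (fun t => (z t, x t)) atTop (𝓝 0)

/-- Absence of Zeno behaviour: `inf_k (t_{k+1} - t_k) > 0` along every maximal execution. -/
def IsZenoFree (γbar : ℝ → ℝ) : Prop :=
  ∀ t₀ T τ z x, IsMaximalExecution q f g γbar t₀ T τ z x →
    ∃ h : ℝ, 0 < h ∧ ∀ k, τ k + (h : EReal) ≤ τ (k + 1)

end System

end EventTriggered

end

/-!
Between two samplings the control `g (x (t_k))` equals `g (x t) - r t`, where the sampling error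
`r t = g (x t) - g (x (t_k))` is the integral of the auxiliary output `ξ`. An execution thus solves
the perturbed closed loop with external input `r` (`IsExecution.isPerturbedSolution`), and the ISS
and BSIBO estimates apply to it. As long as the triggering condition fails, `ρ = ‖r_{[t_k,t]}‖`
satisfies `(t - t_k) γ̄(ρ) < ρ ≤ (t - t_k) sup ‖ξ‖` or `ρ = 0`, so `γ̄(‖r‖) ≤ sup ‖ξ‖`
(`gain_supNorm_le_of_not_triggered`). On the other hand the small-gain condition bounds `‖ξ‖` by
the transients and `γ(‖r‖)`. Since `γ < γ̄` away from zero, this second loop closes as well.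

* With suprema over the whole past this gives bounds by the initial state, hence stability
  (`IsExecution.a_priori`, `StandingAssumptions.stable`). With asymptotic suprema the transients
  disappear and all signals tend to zero (`IsExecution.tendsto_zero`).
* A bound `Ξ` on `ξ` gives `ρ ≤ Ξ` during the first unit of time after a sampling, while `ρ / γ̄(ρ)`
  is bounded below on `(0, Ξ]` because `γ̄(s) / s` has a finite limit at zero. This is a positive
  lower bound on the time to the next sampling (`IsExecution.exists_dwell_time`).
* A bounded execution with finite life time has finitely many samplings and a limit state, from
  which Peano's theorem (`exists_integral_curve_of_continuous`, by Arzelà–Ascoli for equations with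
  a small delay) continues it (`IsExecution.exists_extension_of_last_sample`). The one delicate case
  is a triggering that sets in immediately after the end point with `ρ = 0` there: then the new
  sample does not change the control. Maximal executions exist by Zorn's lemma
  (`exists_isMaximalExecution`), and they never stop (`IsMaximalExecution.eq_top`).
-/

namespace EventTriggered

/-! ### Peano's existence theorem -/

section Peano

variable {E : Type*} [NormedAddCommGroup E] [NormedSpace ℝ E]

/-- The integral operator of the delayed equation `ẏ(t) = F (y (t - d))` with `y = y₀` before
time `0`. -/
noncomputable def delayOperator (F : E → E) (y₀ : E) (d : ℝ) (y : ℝ → E) (t : ℝ) : E :=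
  y₀ + ∫ s in (0 : ℝ)..max t 0, F (y (s - d))

theorem delayOperator_of_nonpos (F : E → E) (y₀ : E) (d : ℝ) (y : ℝ → E) {t : ℝ} (ht : t ≤ 0) :
    delayOperator F y₀ d y t = y₀ := by
  simp [delayOperator, max_eq_right ht]

theorem lipschitzWith_delayOperator {F : E → E} (hF : Continuous F) {V : NNReal}
    (hV : ∀ y, ‖F y‖ ≤ V) (y₀ : E) (d : ℝ) {y : ℝ → E} (hy : Continuous y) :
    LipschitzWith V (delayOperator F y₀ d y) := by
  refine LipschitzWith.of_dist_le_mul fun t s => ?_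
  have hc : Continuous fun s => F (y (s - d)) := by fun_prop
  have h1 : delayOperator F y₀ d y t - delayOperator F y₀ d y s
      = ∫ s in max s 0..max t 0, F (y (s - d)) := by
    simp only [delayOperator, add_sub_add_left_eq_sub]
    exact intervalIntegral.integral_interval_sub_left (hc.intervalIntegrable _ _)
      (hc.intervalIntegrable _ _)
  rw [dist_eq_norm, h1]
  refine (intervalIntegral.norm_integral_le_of_norm_le_const fun s _ => hV _).trans ?_
  gcongr
  rw [Real.dist_eq]
  exact abs_max_sub_max_le_abs _ _ _

/-- Iterating the delay operator `k` times settles the values up to time `k d`. -/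
theorem delayOperator_iterate_stable (F : E → E) (y₀ : E) {d : ℝ} (hd : 0 ≤ d) (k : ℕ) :
    ∀ t ≤ k * d, (delayOperator F y₀ d)^[k + 1] (fun _ => y₀) t
      = (delayOperator F y₀ d)^[k] (fun _ => y₀) t := by
  induction k with
  | zero =>
    intro t ht
    have : t ≤ 0 := by simpa using ht
    simp [delayOperator_of_nonpos _ _ _ _ this]
  | succ k ih =>
    intro t ht
    rw [Function.iterate_succ_apply', Function.iterate_succ_apply' (n := k)]
    refine congrArg (y₀ + ·) (intervalIntegral.integral_congr fun s hs => ?_)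
    rw [uIcc_of_le (le_max_right _ _)] at hs
    have hk : max t 0 ≤ ((k + 1 : ℕ) : ℝ) * d := max_le ht (by positivity)
    have : s - d ≤ k * d := by
      have := hs.2.trans hk
      push_cast at this
      linarith
    refine congrArg F ?_
    rw [← Function.iterate_succ_apply' (delayOperator F y₀ d)]
    exact ih _ this

/-- The delayed equation has a Lipschitz solution up to time `1`. -/
theorem exists_delayed_solution {F : E → E} (hF : Continuous F) {V : NNReal}
    (hV : ∀ y, ‖F y‖ ≤ V) (y₀ : E) {d : ℝ} (hd : 0 < d) :
    ∃ y : ℝ → E, LipschitzWith V y ∧ y 0 = y₀ ∧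
      ∀ t ∈ Icc (0 : ℝ) 1, y t = y₀ + ∫ s in (0 : ℝ)..t, F (y (s - d)) := by
  obtain ⟨N, hN⟩ := exists_nat_gt (1 / d)
  have hN1 : 1 ≤ N * d := by
    have := (div_lt_iff₀ hd).1 hN
    linarith
  have hlip : ∀ k, LipschitzWith V ((delayOperator F y₀ d)^[k] (fun _ => y₀)) := by
    intro k
    induction k with
    | zero => exact LipschitzWith.weaken (LipschitzWith.const _) zero_le
    | succ k ih =>
      rw [Function.iterate_succ_apply']
      exact lipschitzWith_delayOperator hF hV _ _ ih.continuous
  refine ⟨(delayOperator F y₀ d)^[N] (fun _ => y₀), hlip N, ?_, fun t ht => ?_⟩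
  · cases N with
    | zero => rfl
    | succ N =>
      rw [Function.iterate_succ_apply']
      exact delayOperator_of_nonpos _ _ _ _ le_rfl
  · rw [← delayOperator_iterate_stable F y₀ hd.le N t (ht.2.trans hN1),
      Function.iterate_succ_apply']
    simp [delayOperator, max_eq_left ht.1]

/-- Peano's theorem for a bounded continuous vector field: the solutions of the delayed equations
accumulate, by Arzelà–Ascoli, at a solution on the unit interval. -/
theorem exists_integral_curve_of_bounded [FiniteDimensional ℝ E] {F : E → E} (hF : Continuous F)
    {V : NNReal} (hV : ∀ y, ‖F y‖ ≤ V) (y₀ : E) :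
    ∃ y : ℝ → E, y 0 = y₀ ∧ (∀ t ∈ Icc (0 : ℝ) 1, ‖y t - y₀‖ ≤ V * t) ∧
      ∀ t ∈ Icc (0 : ℝ) 1, HasDerivAt y (F (y t)) t := by
  have : ProperSpace E := FiniteDimensional.proper_real E
  have hdpos : ∀ n : ℕ, (0 : ℝ) < 1 / ((n : ℝ) + 1) := fun n => by positivity
  choose y hyL hy0 hyI using fun n : ℕ => exists_delayed_solution hF hV y₀ (hdpos n)
  let u : ℕ → BoundedContinuousFunction (Icc (0 : ℝ) 1) E := fun n =>
    BoundedContinuousFunction.mkOfCompact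
      ⟨fun t => y n t, (hyL n).continuous.comp continuous_subtype_val⟩
  have hcomp : IsCompact (closure (range u)) := by
    refine BoundedContinuousFunction.arzela_ascoli (Metric.closedBall y₀ V)
      (isCompact_closedBall _ _) _ ?_ ?_
    · rintro _ ⟨t, ht⟩ ⟨n, rfl⟩
      have := (hyL n).dist_le_mul t 0
      rw [hy0] at this
      refine Metric.mem_closedBall.2 (this.trans ?_)
      rw [Real.dist_eq, sub_zero, abs_of_nonneg ht.1]
      exact mul_le_of_le_one_right V.2 ht.2
    · refine (LipschitzWith.uniformEquicontinuous _ V ?_).equicontinuous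
      rintro ⟨_, n, rfl⟩
      exact (mul_one V) ▸ (hyL n).comp (LipschitzWith.subtype_val _)
  obtain ⟨v, -, φ, hφ, hlim⟩ := hcomp.tendsto_subseq (x := u) fun n => subset_closure ⟨n, rfl⟩
  let U : ℝ → E := IccExtend zero_le_one v
  have hUc : Continuous U := v.continuous.Icc_extend'
  have hpt : ∀ t ∈ Icc (0 : ℝ) 1, Tendsto (fun n => y (φ n) t) atTop (𝓝 (U t)) := by
    intro t ht
    have h1 : U t = v ⟨t, ht⟩ := IccExtend_of_mem _ _ ht
    rw [h1]
    exact ((continuous_eval_const (⟨t, ht⟩ : Icc (0 : ℝ) 1)).tendsto v).comp hlim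
  have hdel : ∀ t ∈ Icc (0 : ℝ) 1,
      Tendsto (fun n => y (φ n) (t - 1 / ((φ n : ℝ) + 1))) atTop (𝓝 (U t)) := by
    intro t ht
    refine (hpt t ht).congr_dist ?_
    have h0 : Tendsto (fun n => (V : ℝ) * (1 / ((φ n : ℝ) + 1))) atTop (𝓝 0) := by
      simpa using ((tendsto_one_div_add_atTop_nhds_zero_nat (𝕜 := ℝ)).comp
        hφ.tendsto_atTop).const_mul (V : ℝ)
    refine squeeze_zero (fun _ => dist_nonneg) (fun n => ?_) h0
    refine ((hyL (φ n)).dist_le_mul _ _).trans (le_of_eq ?_)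
    rw [Real.dist_eq, sub_sub_cancel, abs_of_pos (hdpos _)]
  have hFU : Continuous fun s => F (U s) := hF.comp hUc
  have hint : ∀ t ∈ Icc (0 : ℝ) 1, U t = y₀ + ∫ s in (0 : ℝ)..t, F (U s) := by
    intro t ht
    refine tendsto_nhds_unique (hpt t ht) ?_
    simp_rw [fun n => hyI (φ n) t ht]
    refine tendsto_const_nhds.add ?_
    refine intervalIntegral.tendsto_integral_filter_of_dominated_convergence (fun _ => (V : ℝ))
      (Eventually.of_forall fun n => ?_) (Eventually.of_forall fun n => ?_) (by simp) ?_
    · exact (hF.comp ((hyL _).continuous.comp (continuous_id.sub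
        continuous_const))).aestronglyMeasurable
    · exact Eventually.of_forall fun s _ => hV _
    · refine Eventually.of_forall fun s hs => ?_
      rw [uIoc_of_le ht.1] at hs
      exact (hF.tendsto _).comp (hdel s ⟨hs.1.le, hs.2.trans ht.2⟩)
  refine ⟨fun t => y₀ + ∫ s in (0 : ℝ)..t, F (U s), by simp, fun t ht => ?_, fun t ht => ?_⟩
  · simp only [add_sub_cancel_left]
    refine (intervalIntegral.norm_integral_le_of_norm_le_const (C := V) fun s _ => hV _).trans ?_
    rw [sub_zero, abs_of_nonneg ht.1]
  · simp only
    rw [← hint t ht]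
    exact (intervalIntegral.integral_hasDerivAt_right (hFU.intervalIntegrable _ _)
      hFU.aestronglyMeasurable.stronglyMeasurableAtFilter hFU.continuousAt).const_add _

/-- **Peano's existence theorem** for an autonomous continuous vector field on a
finite-dimensional space. -/
theorem exists_integral_curve_of_continuous [FiniteDimensional ℝ E] {F : E → E} (hF : Continuous F)
    (y₀ : E) (t₀ : ℝ) :
    ∃ δ > 0, ∃ y : ℝ → E, y t₀ = y₀ ∧ ∀ t ∈ Icc t₀ (t₀ + δ), HasDerivAt y (F (y t)) t := by
  have : ProperSpace E := FiniteDimensional.proper_real E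
  -- The field is made bounded by a retraction `ρ` onto the closed unit ball around `y₀`.
  let ρ : E → E := fun y => y₀ + (max 1 ‖y - y₀‖)⁻¹ • (y - y₀)
  have hρc : Continuous ρ := by
    refine continuous_const.add (Continuous.smul (Continuous.inv₀ (by fun_prop) fun y => ?_)
      (by fun_prop))
    exact (lt_of_lt_of_le one_pos (le_max_left _ _)).ne'
  have hρball : ∀ y, ρ y ∈ Metric.closedBall y₀ 1 := by
    intro y
    have hpos : 0 < max 1 ‖y - y₀‖ := lt_of_lt_of_le one_pos (le_max_left _ _)
    rw [mem_closedBall_iff_norm, add_sub_cancel_left, norm_smul, norm_inv, Real.norm_eq_abs,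
      abs_of_pos hpos, inv_mul_le_iff₀ hpos, mul_one]
    exact le_max_right _ _
  have hρid : ∀ y, ‖y - y₀‖ ≤ 1 → ρ y = y := by
    intro y hy
    simp [ρ, max_eq_left hy]
  obtain ⟨C, hC⟩ := (isCompact_closedBall y₀ 1).exists_bound_of_continuousOn hF.continuousOn
  have hC0 : 0 ≤ C := (norm_nonneg _).trans (hC y₀ (by simp))
  obtain ⟨y, hy0, hyb, hyd⟩ := exists_integral_curve_of_bounded (hF.comp hρc) (V := ⟨C, hC0⟩)
    (fun y => hC _ (hρball y)) y₀
  have hδ1 : 1 / (C + 1) ≤ 1 := by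
    rw [div_le_one (by positivity)]; linarith
  refine ⟨1 / (C + 1), by positivity, fun t => y (t - t₀), by simpa using hy0, fun t ht => ?_⟩
  have ht' : t - t₀ ∈ Icc (0 : ℝ) 1 := ⟨by linarith [ht.1], by linarith [ht.2]⟩
  have hsmall : ‖y (t - t₀) - y₀‖ ≤ 1 := by
    refine (hyb _ ht').trans ?_
    have h2 : t - t₀ ≤ 1 / (C + 1) := by linarith [ht.2]
    calc C * (t - t₀) ≤ C * (1 / (C + 1)) := by gcongr
      _ ≤ 1 := by rw [mul_one_div, div_le_one (by positivity)]; linarith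
  have := hyd _ ht'
  rw [Function.comp, hρid _ hsmall] at this
  exact this.comp_sub_const t t₀

end Peano

/-! ### Comparison functions -/

section Comparison

variable {α : ℝ → ℝ}

theorem IsClassK.mono (h : IsClassK α) {s t : ℝ} (hs : 0 ≤ s) (hst : s ≤ t) : α s ≤ α t :=
  h.strictMonoOn.monotoneOn hs (hs.trans hst) hst

theorem IsClassK.nonneg (h : IsClassK α) {s : ℝ} (hs : 0 ≤ s) : 0 ≤ α s :=
  h.zero ▸ h.mono le_rfl hs

theorem IsClassK.pos (h : IsClassK α) {s : ℝ} (hs : 0 < s) : 0 < α s :=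
  h.zero ▸ h.strictMonoOn self_mem_Ici hs.le hs

theorem IsClassK.le_of_le (h : IsClassK α) {s t : ℝ} (hs : 0 ≤ s) (ht : 0 ≤ t)
    (hst : α s ≤ α t) : s ≤ t :=
  (h.strictMonoOn.le_iff_le hs ht).1 hst

/-- `α (c + e) → α c` as `e ↓ 0`. -/
theorem IsClassK.tendsto_add (h : IsClassK α) {c : ℝ} (hc : 0 ≤ c) :
    Tendsto (fun e => α (c + e)) (𝓝[>] 0) (𝓝 (α c)) := by
  refine (h.continuousOn c hc).tendsto.comp (tendsto_nhdsWithin_iff.2 ⟨?_, ?_⟩)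
  · have : Tendsto (fun e : ℝ => c + e) (𝓝 0) (𝓝 (c + 0)) := tendsto_const_nhds.add tendsto_id
    rw [add_zero] at this
    exact this.mono_left nhdsWithin_le_nhds
  · filter_upwards [self_mem_nhdsWithin] with e he
    exact add_nonneg hc (le_of_lt he)

theorem IsClassK.exists_le (h : IsClassK α) {η : ℝ} (hη : 0 < η) :
    ∃ δ > 0, ∀ s, 0 ≤ s → s ≤ δ → α s ≤ η := by
  have h1 := h.tendsto_add le_rfl
  rw [h.zero] at h1
  obtain ⟨δ, hδ, hδ0⟩ := ((h1.eventually (gt_mem_nhds hη)).and self_mem_nhdsWithin).exists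
  refine ⟨δ, hδ0, fun s hs hsδ => (h.mono hs hsδ).trans ?_⟩
  simpa using hδ.le

theorem IsClassKInf.exists_eq (h : IsClassKInf α) {y : ℝ} (hy : 0 ≤ y) : ∃ s, 0 ≤ s ∧ α s = y := by
  obtain ⟨b, hb, hb0⟩ := ((h.tendsto_atTop.eventually_ge_atTop y).and
    (eventually_ge_atTop 0)).exists
  obtain ⟨s, hs, hsy⟩ := intermediate_value_Icc hb0 (h.continuousOn.mono Icc_subset_Ici_self)
    ⟨h.zero.trans_le hy, hb⟩
  exact ⟨s, hs.1, hsy⟩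

theorem IsClassKL.nonneg {β : ℝ → ℝ → ℝ} (h : IsClassKL β) {s t : ℝ} (hs : 0 ≤ s) (ht : 0 ≤ t) :
    0 ≤ β s t :=
  (h.classK t ht).nonneg hs

theorem IsClassKL.le_zero {β : ℝ → ℝ → ℝ} (h : IsClassKL β) {s t : ℝ} (hs : 0 ≤ s) (ht : 0 ≤ t) :
    β s t ≤ β s 0 :=
  h.antitoneOn s hs self_mem_Ici ht ht

/-- If `γ̄(s) / s` has a limit at `0⁺`, then `s / γ̄(s)` is bounded away from zero on bounded sets.
This is the lower bound on the inter-sampling times. -/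
theorem IsClassKInf.exists_mul_le (h : IsClassKInf α) {C : ℝ}
    (hC : Tendsto (fun s => α s / s) (𝓝[>] 0) (𝓝 C)) (B : ℝ) :
    ∃ h > 0, ∀ ρ, 0 < ρ → ρ ≤ B → h * α ρ ≤ ρ := by
  obtain ⟨d, hd, hdC⟩ := mem_nhdsGT_iff_exists_Ioo_subset.1
    (hC.eventually (gt_mem_nhds (lt_of_le_of_lt (le_abs_self C) (lt_add_one _))))
  have hd : 0 < d := hd
  have hB0 : 0 ≤ α (max B 0) := h.nonneg (le_max_right _ _)
  refine ⟨min (1 / (|C| + 1)) (d / (α (max B 0) + 1)), by positivity, fun ρ hρ hρB => ?_⟩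
  have hα := h.pos hρ
  rcases lt_or_ge ρ d with hlt | hge
  · have h1 : α ρ / ρ < |C| + 1 := hdC ⟨hρ, hlt⟩
    rw [div_lt_iff₀ hρ] at h1
    calc _ ≤ 1 / (|C| + 1) * α ρ := by gcongr; exact min_le_left _ _
      _ ≤ 1 / (|C| + 1) * ((|C| + 1) * ρ) := by gcongr
      _ = ρ := by field_simp
  · have h1 : α ρ ≤ α (max B 0) + 1 := by
      have := h.mono hρ.le (hρB.trans (le_max_left B 0))
      linarith
    calc _ ≤ d / (α (max B 0) + 1) * α ρ := by gcongr; exact min_le_right _ _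
      _ ≤ d / (α (max B 0) + 1) * (α (max B 0) + 1) := by gcongr
      _ = d := by field_simp
      _ ≤ ρ := hge

end Comparison

/-! ### Static small-gain arguments -/

section SmallGain

variable {γzx γzr γxz γxr γξz γξx γξr : ℝ → ℝ}

/-- The small-gain theorem for two numbers that bound each other through `γ_z^x` and `γ_x^z`. -/
theorem small_gain (hγzx : IsClassK γzx) (hsmall : ∀ s > 0, γzx (γxz s) < s) {Z X R bz bx : ℝ}
    (hZ : 0 ≤ Z)
    (hbx : 0 ≤ bx) (hZle : Z ≤ max bz (max (γzx X) (γzr R)))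
    (hXle : X ≤ max bx (max (γxz Z) (γxr R))) (hX : 0 ≤ X) :
    Z ≤ max (max bz (γzx bx)) (barGainZ γzx γzr γxr R) := by
  simp only [barGainZ]
  rcases le_max_iff.1 hZle with h | h
  · exact le_max_of_le_left (le_max_of_le_left h)
  rcases le_max_iff.1 h with h | h
  · rcases le_max_iff.1 hXle with h' | h'
    · exact le_max_of_le_left (le_max_of_le_right (h.trans (hγzx.mono hX h')))
    rcases le_max_iff.1 h' with h' | h'
    · rcases hZ.eq_or_lt with h0 | h0
      · rw [← h0]
        exact le_max_of_le_left (le_max_of_le_right (hγzx.nonneg hbx))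
      · exact absurd (hsmall Z h0) (not_lt.2 (h.trans (hγzx.mono hX h')))
    · exact le_max_of_le_right (le_max_of_le_right (h.trans (hγzx.mono hX h')))
  · exact le_max_of_le_right (le_max_of_le_left h)

/-- The small-gain condition is symmetric in the two loop gains. -/
theorem small_gain_symm (hγzx : IsClassK γzx) (hsmall : ∀ s > 0, γzx (γxz s) < s) :
    ∀ s > 0, γxz (γzx s) < s := by
  intro s hs
  by_contra! hle
  exact absurd (hsmall _ (hγzx.pos hs)) (not_lt.2 (hγzx.mono hs.le hle))

theorem barGainX_eq : barGainX γxz γxr γzr = barGainZ γxz γxr γzr := rfl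

theorem barGainZ_nonneg (hγzr : IsClassK γzr) {s : ℝ} (hs : 0 ≤ s) :
    0 ≤ barGainZ γzx γzr γxr s :=
  le_max_of_le_left (hγzr.nonneg hs)

theorem barGainZ_mono (hγzx : IsClassK γzx) (hγzr : IsClassK γzr) (hγxr : IsClassK γxr)
    {s t : ℝ} (hs : 0 ≤ s) (hst : s ≤ t) :
    barGainZ γzx γzr γxr s ≤ barGainZ γzx γzr γxr t :=
  max_le_max (hγzr.mono hs hst) (hγzx.mono (hγxr.nonneg hs) (hγxr.mono hs hst))

theorem barGainZ_exists_le (hγzx : IsClassK γzx) (hγzr : IsClassK γzr) (hγxr : IsClassK γxr)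
    {η : ℝ} (hη : 0 < η) :
    ∃ δ > 0, ∀ s, 0 ≤ s → s ≤ δ → barGainZ γzx γzr γxr s ≤ η := by
  obtain ⟨δ₁, h1, H1⟩ := hγzr.exists_le hη
  obtain ⟨δ₂, h2, H2⟩ := hγzx.exists_le hη
  obtain ⟨δ₃, h3, H3⟩ := hγxr.exists_le h2
  refine ⟨min δ₁ δ₃, lt_min h1 h3, fun s hs hsδ => max_le ?_ ?_⟩
  · exact H1 s hs (hsδ.trans (min_le_left _ _))
  · exact H2 _ (hγxr.nonneg hs) (H3 s hs (hsδ.trans (min_le_right _ _)))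

theorem compositeGain_pos (hγξr : IsClassK γξr) {s : ℝ} (hs : 0 < s) :
    0 < compositeGain γzx γzr γxz γxr γξz γξx γξr s :=
  lt_max_of_lt_right (lt_max_of_lt_right (hγξr.pos hs))

end SmallGain

/-! ### Suprema of signals -/

section SupNorm

variable {E : Type*} [NormedAddCommGroup E] {w : ℝ → E} {a b : ℝ}

theorem supNorm_le {B : ℝ} (hB : 0 ≤ B) (h : ∀ s ∈ Icc a b, ‖w s‖ ≤ B) : supNorm w a b ≤ B :=
  Real.sSup_le (by rintro _ ⟨s, hs, rfl⟩; exact h s hs) hB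

theorem supNorm_nonneg : 0 ≤ supNorm w a b :=
  Real.sSup_nonneg (by rintro _ ⟨s, -, rfl⟩; exact norm_nonneg _)

theorem le_supNorm {B : ℝ} (h : ∀ s ∈ Icc a b, ‖w s‖ ≤ B) {s : ℝ} (hs : s ∈ Icc a b) :
    ‖w s‖ ≤ supNorm w a b :=
  le_csSup ⟨B, by rintro _ ⟨s, hs, rfl⟩; exact h s hs⟩ ⟨s, hs, rfl⟩

theorem ContinuousOn.le_supNorm (h : ContinuousOn w (Icc a b)) {s : ℝ} (hs : s ∈ Icc a b) :
    ‖w s‖ ≤ supNorm w a b :=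
  let ⟨_, hC⟩ := isCompact_Icc.exists_bound_of_continuousOn h
  EventTriggered.le_supNorm hC hs

theorem supNorm_congr {w' : ℝ → E} (h : EqOn w w' (Icc a b)) : supNorm w a b = supNorm w' a b := by
  unfold supNorm
  congr 1
  exact image_congr fun s hs => by rw [h hs]

/-- The running supremum of a continuous signal is continuous from the right. -/
theorem tendsto_supNorm_right {c : ℝ} (hab : a ≤ b) (hbc : b < c) (h : ContinuousOn w (Ico a c)) :
    Tendsto (supNorm w a) (𝓝[≥] b) (𝓝 (supNorm w a b)) := by
  have hle : ∀ t ∈ Ico b c, supNorm w a b ≤ supNorm w a t := fun t ht =>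
    supNorm_le supNorm_nonneg fun s hs =>
      ContinuousOn.le_supNorm (h.mono fun u hu => ⟨hu.1, hu.2.trans_lt ht.2⟩)
        ⟨hs.1, hs.2.trans ht.1⟩
  rw [Metric.tendsto_nhds]
  intro e he
  have hw : Tendsto (fun t => ‖w t‖) (𝓝[≥] b) (𝓝 ‖w b‖) := by
    refine (((h b ⟨hab, hbc⟩).mono_of_mem_nhdsWithin ?_)).norm
    exact mem_of_superset (Ico_mem_nhdsGE hbc) (Ico_subset_Ico_left hab)
  have hwb : ‖w b‖ ≤ supNorm w a b :=
    ContinuousOn.le_supNorm (h.mono fun u hu => ⟨hu.1, hu.2.trans_lt hbc⟩) ⟨hab, le_rfl⟩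
  have hev : ∀ᶠ t in 𝓝[≥] b, ‖w t‖ < supNorm w a b + e / 2 :=
    hw.eventually (gt_mem_nhds (by linarith))
  obtain ⟨d, hd, hdw⟩ := mem_nhdsGE_iff_exists_Ico_subset.1 hev
  filter_upwards [Ico_mem_nhdsGE (lt_min hd hbc)] with t ht
  have htd : t < d := ht.2.trans_le (min_le_left _ _)
  have htc : t < c := ht.2.trans_le (min_le_right _ _)
  have h1 := hle t ⟨ht.1, htc⟩
  have h2 : supNorm w a t ≤ supNorm w a b + e / 2 := by
    refine supNorm_le (by have := supNorm_nonneg (w := w) (a := a) (b := b); linarith)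
      fun s hs => ?_
    rcases le_total s b with hsb | hsb
    · have := ContinuousOn.le_supNorm (h.mono fun u hu => ⟨hu.1, hu.2.trans_lt hbc⟩)
        (⟨hs.1, hsb⟩ : s ∈ Icc a b)
      linarith
    · exact le_of_lt (hdw ⟨hsb, hs.2.trans_lt htd⟩)
  rw [Real.dist_eq, abs_of_nonneg (by linarith)]
  linarith

end SupNorm

/-! ### Trajectories under a constant control -/

section Hold

variable {p n m : ℕ}
  {q : EuclideanSpace ℝ (Fin p) × EuclideanSpace ℝ (Fin n) × EuclideanSpace ℝ (Fin m) →
    EuclideanSpace ℝ (Fin p)}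
  {f : EuclideanSpace ℝ (Fin p) × EuclideanSpace ℝ (Fin n) × EuclideanSpace ℝ (Fin m) →
    EuclideanSpace ℝ (Fin n)}
  {g : EuclideanSpace ℝ (Fin n) → EuclideanSpace ℝ (Fin m)}
  {z : ℝ → EuclideanSpace ℝ (Fin p)} {x x' : ℝ → EuclideanSpace ℝ (Fin n)}
  {v : EuclideanSpace ℝ (Fin m)} {γbar : ℝ → ℝ} {a b s t Ξ : ℝ}

/-- `(z, x)` solves `ż = q(z, x, v)`, `ẋ = f(z, x, v)` on `[s, b)` for the constant control `v`. -/
structure IsHoldSolution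
    (q : EuclideanSpace ℝ (Fin p) × EuclideanSpace ℝ (Fin n) × EuclideanSpace ℝ (Fin m) →
      EuclideanSpace ℝ (Fin p))
    (f : EuclideanSpace ℝ (Fin p) × EuclideanSpace ℝ (Fin n) × EuclideanSpace ℝ (Fin m) →
      EuclideanSpace ℝ (Fin n))
    (v : EuclideanSpace ℝ (Fin m)) (s b : ℝ) (z : ℝ → EuclideanSpace ℝ (Fin p))
    (x : ℝ → EuclideanSpace ℝ (Fin n)) : Prop where
  continuousOn_z : ContinuousOn z (Ico s b)
  continuousOn_x : ContinuousOn x (Ico s b)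
  deriv_z : ∀ t ∈ Ico s b, HasDerivWithinAt z (q (z t, x t, v)) (Ici t) t
  deriv_x : ∀ t ∈ Ico s b, HasDerivWithinAt x (f (z t, x t, v)) (Ici t) t

theorem IsHoldSolution.mono (h : IsHoldSolution q f v s b z x) {s' b' : ℝ} (hs : s ≤ s')
    (hb : b' ≤ b) : IsHoldSolution q f v s' b' z x :=
  have hsub : Ico s' b' ⊆ Ico s b := Ico_subset_Ico hs hb
  ⟨h.continuousOn_z.mono hsub, h.continuousOn_x.mono hsub, fun t ht => h.deriv_z t (hsub ht),
    fun t ht => h.deriv_x t (hsub ht)⟩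

theorem exists_isHoldSolution (hq : Continuous q) (hf : Continuous f)
    (v : EuclideanSpace ℝ (Fin m)) (s : ℝ) (z₀ : EuclideanSpace ℝ (Fin p))
    (x₀ : EuclideanSpace ℝ (Fin n)) :
    ∃ δ > 0, ∃ z x, IsHoldSolution q f v s (s + δ) z x ∧ z s = z₀ ∧ x s = x₀ := by
  let F : EuclideanSpace ℝ (Fin p) × EuclideanSpace ℝ (Fin n) →
      EuclideanSpace ℝ (Fin p) × EuclideanSpace ℝ (Fin n) :=
    fun y => (q (y.1, y.2, v), f (y.1, y.2, v))
  have hF : Continuous F := by fun_prop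
  obtain ⟨δ, hδ, y, hy0, hy⟩ := exists_integral_curve_of_continuous hF (z₀, x₀) s
  have hz : ∀ t ∈ Ico s (s + δ), HasDerivAt (fun t => (y t).1) (q ((y t).1, (y t).2, v)) t :=
    fun t ht => (hasFDerivAt_fst (𝕜 := ℝ) (p := y t)).comp_hasDerivAt t
      (hy t ⟨ht.1, ht.2.le⟩)
  have hx : ∀ t ∈ Ico s (s + δ), HasDerivAt (fun t => (y t).2) (f ((y t).1, (y t).2, v)) t :=
    fun t ht => (hasFDerivAt_snd (𝕜 := ℝ) (p := y t)).comp_hasDerivAt t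
      (hy t ⟨ht.1, ht.2.le⟩)
  exact ⟨δ, hδ, fun t => (y t).1, fun t => (y t).2,
    ⟨fun t ht => (hz t ht).continuousAt.continuousWithinAt,
      fun t ht => (hx t ht).continuousAt.continuousWithinAt,
      fun t ht => (hz t ht).hasDerivWithinAt, fun t ht => (hx t ht).hasDerivWithinAt⟩,
    congrArg Prod.fst hy0, congrArg Prod.snd hy0⟩

theorem IsHoldSolution.hasDerivWithinAt_comp (h : IsHoldSolution q f v s b z x)
    (hg : ContDiff ℝ 1 g) (ht : t ∈ Ico s b) :
    HasDerivWithinAt (fun σ => g (x σ)) (fderiv ℝ g (x t) (f (z t, x t, v))) (Ici t) t :=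
  ((hg.differentiable one_ne_zero) (x t)).hasFDerivAt.comp_hasDerivWithinAt t (h.deriv_x t ht)

theorem IsHoldSolution.auxOutput_eq (h : IsHoldSolution q f v s b z x) (hg : ContDiff ℝ 1 g)
    (ht : t ∈ Ico s b) : auxOutput g x t = fderiv ℝ g (x t) (f (z t, x t, v)) :=
  (h.hasDerivWithinAt_comp hg ht).derivWithin (uniqueDiffWithinAt_Ici t)

theorem IsHoldSolution.continuousOn_auxOutput (h : IsHoldSolution q f v s b z x)
    (hf : Continuous f) (hg : ContDiff ℝ 1 g) : ContinuousOn (auxOutput g x) (Ico s b) := by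
  have h1 : ContinuousOn (fun t => fderiv ℝ g (x t)) (Ico s b) :=
    (hg.continuous_fderiv one_ne_zero).comp_continuousOn h.continuousOn_x
  have h2 : ContinuousOn (fun t => f (z t, x t, v)) (Ico s b) :=
    hf.comp_continuousOn (h.continuousOn_z.prodMk (h.continuousOn_x.prodMk continuousOn_const))
  exact (h1.clm_apply h2).congr fun t ht => h.auxOutput_eq hg ht

/-- Under a constant control the auxiliary input is the sampling error `g(x(t)) - g(x(s))`. -/
theorem IsHoldSolution.auxInput_eq (h : IsHoldSolution q f v s b z x) (hf : Continuous f)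
    (hg : ContDiff ℝ 1 g) (ht : t ∈ Ico s b) : auxInput g x s t = g (x t) - g (x s) := by
  have hsub : Icc s t ⊆ Ico s b := fun σ hσ => ⟨hσ.1, hσ.2.trans_lt ht.2⟩
  refine intervalIntegral.integral_eq_sub_of_hasDeriv_right_of_le (f := fun σ => g (x σ)) ht.1
    (hg.continuous.comp_continuousOn (h.continuousOn_x.mono hsub)) (fun σ hσ => ?_)
    (((h.continuousOn_auxOutput hf hg).mono hsub).intervalIntegrable_of_Icc ht.1)
  have hσ' := hsub ⟨hσ.1.le, hσ.2.le⟩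
  rw [h.auxOutput_eq hg hσ']
  exact (h.hasDerivWithinAt_comp hg hσ').mono Ioi_subset_Ici_self

theorem IsHoldSolution.continuousOn_auxInput (h : IsHoldSolution q f v s b z x)
    (hf : Continuous f) (hg : ContDiff ℝ 1 g) : ContinuousOn (auxInput g x s) (Ico s b) :=
  ((hg.continuous.comp_continuousOn h.continuousOn_x).sub continuousOn_const).congr
    fun _ ht => h.auxInput_eq hf hg ht

theorem norm_auxInput_le (hst : s ≤ t) (hΞ : ∀ σ ∈ Ioc s t, ‖auxOutput g x σ‖ ≤ Ξ) :
    ‖auxInput g x s t‖ ≤ (t - s) * Ξ := by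
  have := intervalIntegral.norm_integral_le_of_norm_le_const (a := s) (b := t)
    (f := auxOutput g x) (C := Ξ) (by rwa [uIoc_of_le hst])
  rwa [abs_of_nonneg (sub_nonneg.2 hst), mul_comm] at this

theorem supNorm_auxInput_le (hst : s ≤ t) (hΞ0 : 0 ≤ Ξ)
    (hΞ : ∀ σ ∈ Ioc s t, ‖auxOutput g x σ‖ ≤ Ξ) :
    supNorm (auxInput g x s) s t ≤ (t - s) * Ξ := by
  refine supNorm_le (mul_nonneg (sub_nonneg.2 hst) hΞ0) fun σ hσ => ?_
  refine (norm_auxInput_le hσ.1 fun u hu => hΞ u ⟨hu.1, hu.2.trans hσ.2⟩).trans ?_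
  gcongr
  exact hσ.2

/-- As long as the triggering condition fails, `γ̄(‖r‖)` is bounded by the auxiliary output:
`(t - s) γ̄(ρ) < ρ ≤ (t - s) sup ‖ξ‖`. -/
theorem gain_supNorm_le_of_not_triggered (hγ : IsClassKInf γbar) (hst : s < t) (hΞ0 : 0 ≤ Ξ)
    (hΞ : ∀ σ ∈ Ioc s t, ‖auxOutput g x σ‖ ≤ Ξ) (h : ¬ Triggered g γbar x s t) :
    γbar (supNorm (auxInput g x s) s t) ≤ Ξ := by
  by_cases h0 : supNorm (auxInput g x s) s t = 0
  · rwa [h0, hγ.zero]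
  · have h1 : (t - s) * γbar (supNorm (auxInput g x s) s t) < supNorm (auxInput g x s) s t := by
      by_contra! hle
      exact h ⟨h0, hle⟩
    exact le_of_lt (lt_of_mul_lt_mul_left (h1.trans_le (supNorm_auxInput_le hst.le hΞ0 hΞ))
      (sub_pos.2 hst).le)

/-- There is no triggering within a time that depends only on a bound for the auxiliary output. -/
theorem not_triggered_of_sub_lt (hγ : IsClassKInf γbar) (hst : s < t) (hΞ0 : 0 ≤ Ξ)
    (hΞ : ∀ σ ∈ Ioc s t, ‖auxOutput g x σ‖ ≤ Ξ) {d : ℝ}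
    (hd : ∀ ρ, 0 < ρ → ρ ≤ Ξ → d * γbar ρ ≤ ρ) (ht1 : t - s ≤ 1) (htd : t - s < d) :
    ¬ Triggered g γbar x s t := by
  rintro ⟨h0, hle⟩
  have hpos : 0 < supNorm (auxInput g x s) s t := lt_of_le_of_ne supNorm_nonneg (Ne.symm h0)
  have hB : supNorm (auxInput g x s) s t ≤ Ξ :=
    (supNorm_auxInput_le hst.le hΞ0 hΞ).trans (mul_le_of_le_one_left hΞ0 ht1)
  have h1 := hd _ hpos hB
  have h2 := mul_lt_mul_of_pos_right htd (hγ.pos hpos)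
  linarith

theorem IsHoldSolution.exists_forall_not_triggered (h : IsHoldSolution q f v s b z x)
    (hf : Continuous f) (hg : ContDiff ℝ 1 g) (hγ : IsClassKInf γbar) {C : ℝ}
    (hC : Tendsto (fun σ => γbar σ / σ) (𝓝[>] 0) (𝓝 C)) (hsb : s < b) :
    ∃ b' ∈ Ioc s b, ∀ t ∈ Ioo s b', ¬ Triggered g γbar x s t := by
  obtain ⟨c, hsc, hcb⟩ := exists_between hsb
  obtain ⟨Ξ, hΞ⟩ := isCompact_Icc.exists_bound_of_continuousOn
    ((h.continuousOn_auxOutput hf hg).mono fun σ (hσ : σ ∈ Icc s c) => ⟨hσ.1, hσ.2.trans_lt hcb⟩)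
  have hΞ0 : 0 ≤ Ξ := (norm_nonneg _).trans (hΞ s ⟨le_rfl, hsc.le⟩)
  obtain ⟨d, hd, hdm⟩ := hγ.exists_mul_le hC Ξ
  refine ⟨min c (s + min 1 d), ⟨lt_min hsc (by have := lt_min one_pos hd; linarith),
    (min_le_left _ _).trans hcb.le⟩, fun t ht => ?_⟩
  have h1 : t < c := ht.2.trans_le (min_le_left _ _)
  have h2 : t - s < min 1 d := by have := ht.2.trans_le (min_le_right _ _); linarith
  exact not_triggered_of_sub_lt hγ ht.1 hΞ0 (fun σ hσ => hΞ σ ⟨hσ.1.le, hσ.2.trans h1.le⟩) hdm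
    (h2.le.trans (min_le_left _ _)) (h2.trans_le (min_le_right _ _))

theorem auxOutput_congr (h : EqOn x x' (Ico a b)) (ht : t ∈ Ico a b) :
    auxOutput g x t = auxOutput g x' t := by
  refine Filter.EventuallyEq.derivWithin_eq ?_ ?_
  · filter_upwards [Ico_mem_nhdsGE ht.2] with σ hσ
    rw [h ⟨ht.1.trans hσ.1, hσ.2⟩]
  · simp only [h ht]

theorem auxInput_congr (h : EqOn x x' (Ico a b)) (has : a ≤ s) (hst : s ≤ t) (htb : t ≤ b) :
    auxInput g x s t = auxInput g x' s t := by
  refine intervalIntegral.integral_congr_ae ?_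
  -- the right derivatives may differ at the right end point, a null set
  have hne : ∀ᵐ σ : ℝ, σ ≠ t := compl_mem_ae_iff.2 (measure_singleton t)
  filter_upwards [hne] with σ hσt hσ
  rw [uIoc_of_le hst] at hσ
  exact auxOutput_congr h ⟨has.trans hσ.1.le, (lt_of_le_of_ne hσ.2 hσt).trans_le htb⟩

/-- The triggering condition depends only on the past of the trajectory. -/
theorem triggered_congr (h : EqOn x x' (Ico a b)) (has : a ≤ s) (htb : t ≤ b) :
    Triggered g γbar x s t ↔ Triggered g γbar x' s t := by
  have : supNorm (auxInput g x s) s t = supNorm (auxInput g x' s) s t :=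
    supNorm_congr fun σ hσ => auxInput_congr h has hσ.1 (hσ.2.trans htb)
  simp only [Triggered, this]

/-- Where the triggering condition fails with a non-zero auxiliary input, it keeps failing for
some time. -/
theorem IsHoldSolution.exists_forall_not_triggered_of_ne_zero
    (h : IsHoldSolution q f v s b z x) (hf : Continuous f) (hg : ContDiff ℝ 1 g)
    (hγ : IsClassKInf γbar) (ht : t ∈ Ico s b) (hnt : ¬ Triggered g γbar x s t)
    (h0 : supNorm (auxInput g x s) s t ≠ 0) :
    ∃ c ∈ Ioc t b, ∀ σ ∈ Ico t c, ¬ Triggered g γbar x s σ := by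
  have hlim := tendsto_supNorm_right ht.1 ht.2 (h.continuousOn_auxInput hf hg)
  have hpos : 0 < supNorm (auxInput g x s) s t := lt_of_le_of_ne supNorm_nonneg (Ne.symm h0)
  have hγlim : Tendsto (fun σ => γbar (supNorm (auxInput g x s) s σ)) (𝓝[≥] t)
      (𝓝 (γbar (supNorm (auxInput g x s) s t))) :=
    (hγ.continuousOn _ supNorm_nonneg).tendsto.comp
      (tendsto_nhdsWithin_iff.2 ⟨hlim, Eventually.of_forall fun _ => supNorm_nonneg⟩)
  have hlt : (t - s) * γbar (supNorm (auxInput g x s) s t) < supNorm (auxInput g x s) s t := by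
    by_contra! hle
    exact hnt ⟨h0, hle⟩
  have hid : Tendsto (fun σ : ℝ => σ - s) (𝓝[≥] t) (𝓝 (t - s)) :=
    ((continuous_sub_right s).tendsto t).mono_left nhdsWithin_le_nhds
  have hev := (hid.mul hγlim).eventually_lt hlim hlt
  obtain ⟨d, hd, hdw⟩ := mem_nhdsGE_iff_exists_Ico_subset.1 hev
  refine ⟨min d b, ⟨lt_min hd ht.2, min_le_right _ _⟩, fun σ hσ hT => ?_⟩
  have : σ ∈ Ico t d := ⟨hσ.1, hσ.2.trans_le (min_le_left _ _)⟩
  exact absurd (hdw this) (not_lt.2 hT.2)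

end Hold

/-! ### Executions and their sampling instants -/

section Execution

variable {p n m : ℕ}
  {q : EuclideanSpace ℝ (Fin p) × EuclideanSpace ℝ (Fin n) × EuclideanSpace ℝ (Fin m) →
    EuclideanSpace ℝ (Fin p)}
  {f : EuclideanSpace ℝ (Fin p) × EuclideanSpace ℝ (Fin n) × EuclideanSpace ℝ (Fin m) →
    EuclideanSpace ℝ (Fin n)}
  {g : EuclideanSpace ℝ (Fin n) → EuclideanSpace ℝ (Fin m)}
  {z : ℝ → EuclideanSpace ℝ (Fin p)} {x : ℝ → EuclideanSpace ℝ (Fin n)}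
  {γbar : ℝ → ℝ} {t₀ : ℝ} {T : EReal} {τ : ℕ → EReal}

theorem nextSample_top : nextSample g γbar x T ⊤ = ⊤ := by
  refine sInf_eq_top.2 ?_
  rintro _ ⟨tk, t, h, -⟩
  exact absurd h.symm (EReal.coe_ne_top _)

theorem le_nextSample (s : EReal) : s ≤ nextSample g γbar x T s := by
  refine le_sInf ?_
  rintro _ ⟨tk, t, rfl, rfl, h, -⟩
  exact EReal.coe_le_coe_iff.2 h.le

theorem nextSample_le {s t : ℝ} (hst : s < t) (htT : (t : EReal) < T)
    (h : Triggered g γbar x s t) : nextSample g γbar x T s ≤ t :=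
  sInf_le ⟨s, t, rfl, rfl, hst, htT, h⟩

theorem le_nextSample_of_forall {s : ℝ} {b : EReal}
    (h : ∀ t : ℝ, s < t → (t : EReal) < T → (t : EReal) < b → ¬ Triggered g γbar x s t) :
    b ≤ nextSample g γbar x T s := by
  refine le_sInf ?_
  rintro _ ⟨tk, t, hs, rfl, hst, htT, htr⟩
  obtain rfl := EReal.coe_injective hs
  by_contra! hlt
  exact h t hst htT hlt htr

theorem nextSample_eq_top {s : ℝ}
    (h : ∀ t : ℝ, s < t → (t : EReal) < T → ¬ Triggered g γbar x s t) :
    nextSample g γbar x T s = ⊤ :=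
  top_le_iff.1 (le_nextSample_of_forall fun t h1 h2 _ => h t h1 h2)

theorem nextSample_lt {s : EReal} (h : nextSample g γbar x T s ≠ ⊤) :
    nextSample g γbar x T s < T := by
  obtain ⟨σ, hσ, -⟩ : ∃ σ ∈ {σ : EReal | ∃ tk t : ℝ, s = (tk : EReal) ∧ σ = (t : EReal) ∧ tk < t ∧
      (t : EReal) < T ∧ Triggered g γbar x tk t}, σ ≠ ⊤ := by
    by_contra! hne
    exact h (sInf_eq_top.2 hne)
  obtain ⟨tk, t, rfl, rfl, h1, h2, h3⟩ := hσ
  exact (nextSample_le h1 h2 h3).trans_lt h2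

namespace IsExecution

variable (E : IsExecution q f g γbar t₀ T τ z x)
include E

theorem monotone : Monotone τ :=
  monotone_nat_of_le_succ fun k => E.sample_succ k ▸ le_nextSample _

theorem start_le (k : ℕ) : (t₀ : EReal) ≤ τ k :=
  E.sample_zero ▸ E.monotone (Nat.zero_le k)

theorem lt_of_ne_top {k : ℕ} (h : τ k ≠ ⊤) : τ k < T := by
  cases k with
  | zero => exact E.sample_zero ▸ E.start_lt
  | succ k =>
    rw [E.sample_succ] at h ⊢
    exact nextSample_lt h

theorem exists_real {k : ℕ} (h : τ k ≠ ⊤) : ∃ tk : ℝ, τ k = tk ∧ t₀ ≤ tk := by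
  have h1 := E.start_le k
  have h2 : τ k ≠ ⊥ := fun hb => by simp [hb] at h1
  refine ⟨(τ k).toReal, (EReal.coe_toReal h h2).symm, ?_⟩
  rwa [← EReal.coe_le_coe_iff, EReal.coe_toReal h h2]

/-- Sampling instants do not repeat: otherwise the sequence `τ` would be stationary and could not
cover the life time. -/
theorem lt_succ {k : ℕ} (h : τ k ≠ ⊤) : τ k < τ (k + 1) := by
  refine lt_of_le_of_ne (E.monotone k.le_succ) fun heq => ?_
  have hconst : ∀ i, τ (k + i) = τ k := by
    intro i
    induction i with
    | zero => rfl
    | succ i ih => rw [← add_assoc, E.sample_succ, ih, ← E.sample_succ, heq]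
  have hsup : ⨆ j, τ j ≤ τ k := iSup_le fun j =>
    (E.monotone (Nat.le_add_left j k)).trans (hconst j).le
  exact absurd (E.covered.trans hsup) (not_le.2 (E.lt_of_ne_top h))

theorem exists_lt_sample {t : ℝ} (ht : (t : EReal) < T) : ∃ k, (t : EReal) < τ k :=
  lt_iSup_iff.1 (ht.trans_le E.covered)

/-- Every time of the life span lies in a unique sampling interval; here, existence. -/
theorem exists_piece {t : ℝ} (h0 : t₀ ≤ t) (ht : (t : EReal) < T) :
    ∃ (k : ℕ) (tk : ℝ), τ k = tk ∧ t₀ ≤ tk ∧ tk ≤ t ∧ (t : EReal) < τ (k + 1) := by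
  classical
  have hex := E.exists_lt_sample ht
  have hspec := Nat.find_spec hex
  have hmin := fun j => Nat.find_min (H := hex) (m := j)
  cases hk : Nat.find hex with
  | zero =>
    rw [hk, E.sample_zero, EReal.coe_lt_coe_iff] at hspec
    exact absurd h0 (not_le.2 hspec)
  | succ k =>
    rw [hk] at hspec
    have h1 : τ k ≤ t := not_lt.1 (hmin k (by omega))
    obtain ⟨tk, htk, h0k⟩ := E.exists_real (k := k)
      (ne_top_of_le_ne_top (EReal.coe_ne_top t) h1)
    rw [htk, EReal.coe_le_coe_iff] at h1
    exact ⟨k, tk, htk, h0k, h1, hspec⟩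

theorem continuousAt_x {t : ℝ} (h0 : t₀ < t) (ht : (t : EReal) < T) : ContinuousAt x t := by
  refine (E.continuousOn_x t ⟨h0.le, ht⟩).continuousAt ?_
  have hU : IsOpen {s : ℝ | (s : EReal) < T} := isOpen_lt continuous_coe_real_ereal continuous_const
  filter_upwards [Ioi_mem_nhds h0, hU.mem_nhds ht] with s h1 h2
  exact ⟨le_of_lt h1, h2⟩

theorem isHoldSolution {k : ℕ} {tk b : ℝ} (hk : τ k = tk) (hb : (b : EReal) ≤ τ (k + 1))
    (hbT : (b : EReal) ≤ T) : IsHoldSolution q f (g (x tk)) tk b z x := by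
  have h0 : t₀ ≤ tk := by have := E.start_le k; rwa [hk, EReal.coe_le_coe_iff] at this
  have hsub : ∀ t ∈ Ico tk b, t₀ ≤ t ∧ (t : EReal) < T := fun t ht =>
    ⟨h0.trans ht.1, (EReal.coe_lt_coe_iff.2 ht.2).trans_le hbT⟩
  exact ⟨E.continuousOn_z.mono hsub, E.continuousOn_x.mono hsub,
    fun t ht => E.deriv_z k tk t hk ht.1 ((EReal.coe_lt_coe_iff.2 ht.2).trans_le hb) (hsub t ht).2,
    fun t ht => E.deriv_x k tk t hk ht.1 ((EReal.coe_lt_coe_iff.2 ht.2).trans_le hb) (hsub t ht).2⟩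

theorem exists_isHoldSolution {k : ℕ} {tk t : ℝ} (hk : τ k = tk)
    (ht : (t : EReal) < τ (k + 1)) (htT : (t : EReal) < T) :
    ∃ b : ℝ, t < b ∧ (b : EReal) < τ (k + 1) ∧ (b : EReal) < T ∧
      IsHoldSolution q f (g (x tk)) tk b z x := by
  obtain ⟨b, h1, h2⟩ := EReal.lt_iff_exists_real_btwn.1 (lt_min ht htT)
  have hb1 := h2.trans_le (min_le_left _ _)
  have hb2 := h2.trans_le (min_le_right _ _)
  exact ⟨b, EReal.coe_lt_coe_iff.1 h1, hb1, hb2, E.isHoldSolution hk hb1.le hb2.le⟩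

theorem not_triggered {k : ℕ} {tk t : ℝ} (hk : τ k = tk) (hkt : tk < t)
    (ht : (t : EReal) < τ (k + 1)) (htT : (t : EReal) < T) : ¬ Triggered g γbar x tk t := by
  intro h
  rw [E.sample_succ, hk] at ht
  exact absurd (nextSample_le hkt htT h) (not_le.2 ht)

end IsExecution

/-! ### The sampling error as an external input -/

/-- The last sampling instant up to time `t`. -/
noncomputable def lastSample (τ : ℕ → EReal) (t : ℝ) : ℝ :=
  sSup {s : ℝ | ∃ k, τ k = (s : EReal) ∧ s ≤ t}

/-- The sampling error `g(x(t)) - u(t)`, which on each sampling interval is the auxiliary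
input. -/
noncomputable def samplingError (g : EuclideanSpace ℝ (Fin n) → EuclideanSpace ℝ (Fin m))
    (x : ℝ → EuclideanSpace ℝ (Fin n)) (τ : ℕ → EReal) (t : ℝ) : EuclideanSpace ℝ (Fin m) :=
  g (x t) - g (x (lastSample τ t))

namespace IsExecution

variable (E : IsExecution q f g γbar t₀ T τ z x)
include E

theorem lastSample_eq {k : ℕ} {tk t : ℝ} (hk : τ k = tk) (hkt : tk ≤ t)
    (ht : (t : EReal) < τ (k + 1)) : lastSample τ t = tk := by
  refine IsGreatest.csSup_eq ⟨⟨k, hk, hkt⟩, ?_⟩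
  rintro s ⟨j, hj, hst⟩
  have hjk : j ≤ k := by
    by_contra! hlt
    have := ht.trans_le (E.monotone hlt)
    rw [hj, EReal.coe_lt_coe_iff] at this
    exact absurd hst (not_le.2 this)
  have := E.monotone hjk
  rwa [hk, hj, EReal.coe_le_coe_iff] at this

theorem samplingError_eq {k : ℕ} {tk t : ℝ} (hk : τ k = tk) (hkt : tk ≤ t)
    (ht : (t : EReal) < τ (k + 1)) : samplingError g x τ t = g (x t) - g (x tk) := by
  rw [samplingError, E.lastSample_eq hk hkt ht]

theorem isAdmissibleInput (hg : Continuous g) {a b : ℝ} (ha : t₀ ≤ a) (hb : (b : EReal) < T) :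
    IsAdmissibleInput (samplingError g x τ) a b := by
  have hltT : ∀ t, t < b → (t : EReal) < T := fun t ht => (EReal.coe_lt_coe_iff.2 ht).trans hb
  have hcontAt : ∀ {k : ℕ} {tk t : ℝ}, τ k = tk → t₀ ≤ tk → tk < t → (t : EReal) < τ (k + 1) →
      t < b → ContinuousAt (samplingError g x τ) t := by
    intro k tk t hk h0 hkt ht htb
    have hx := E.continuousAt_x (h0.trans_lt hkt) (hltT t htb)
    refine ((hg.continuousAt.comp hx).sub continuousAt_const).congr
      (f := fun s => g (x s) - g (x tk)) ?_
    have hU : IsOpen {s : ℝ | (s : EReal) < τ (k + 1)} :=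
      isOpen_lt continuous_coe_real_ereal continuous_const
    filter_upwards [Ioi_mem_nhds hkt, hU.mem_nhds ht] with s h1 h2
    exact (E.samplingError_eq hk (le_of_lt h1) h2).symm
  refine ⟨?_, fun t ht => ?_, fun t ht => ?_, ?_⟩
  · obtain ⟨K, hK⟩ := E.exists_lt_sample hb
    refine ⟨(Finset.range K).image fun k => (τ k).toReal, fun t ht htS => ?_⟩
    obtain ⟨k, tk, hk, h0, hkt, htk⟩ := E.exists_piece (ha.trans ht.1.le) (hltT t ht.2)
    refine hcontAt hk h0 (lt_of_le_of_ne hkt ?_) htk ht.2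
    rintro rfl
    refine htS (Finset.mem_image.2 ⟨k, Finset.mem_range.2 ?_, by simp [hk]⟩)
    by_contra! hKk
    have := hK.trans_le (E.monotone hKk)
    rw [hk, EReal.coe_lt_coe_iff] at this
    exact absurd ht.2 (not_lt.2 this.le)
  · obtain ⟨k, tk, hk, h0, hkt, htk⟩ := E.exists_piece (ha.trans ht.1) (hltT t ht.2)
    obtain ⟨c, htc, -, -, hH⟩ := E.exists_isHoldSolution hk htk (hltT t ht.2)
    have hx : ContinuousWithinAt x (Ici t) t :=
      (hH.deriv_x t ⟨hkt, htc⟩).continuousWithinAt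
    have hU : IsOpen {s : ℝ | (s : EReal) < τ (k + 1)} :=
      isOpen_lt continuous_coe_real_ereal continuous_const
    refine ((hg.continuousAt.comp_continuousWithinAt hx).sub continuousWithinAt_const
      (g := fun _ => g (x tk))).congr_of_eventuallyEq ?_ (E.samplingError_eq hk hkt htk)
    filter_upwards [self_mem_nhdsWithin, mem_nhdsWithin_of_mem_nhds (hU.mem_nhds htk)] with s h1 h2
    exact E.samplingError_eq hk (hkt.trans h1) h2
  · obtain ⟨k, tk, hk, h0, hkt, htk⟩ := E.exists_piece (ha.trans ht.1.le) (hltT t ht.2)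
    rcases hkt.lt_or_eq with hlt | rfl
    · exact ⟨_, (hcontAt hk h0 hlt htk ht.2).tendsto.mono_left nhdsWithin_le_nhds⟩
    · cases k with
      | zero =>
        rw [E.sample_zero] at hk
        exact absurd (EReal.coe_injective hk) (ha.trans_lt ht.1).ne
      | succ j =>
        have hj : τ j ≠ ⊤ := ne_top_of_le_ne_top (by rw [hk]; exact EReal.coe_ne_top _)
          (E.monotone j.le_succ)
        obtain ⟨tj, htj, h0j⟩ := E.exists_real hj
        have hlt := E.lt_succ hj
        rw [htj, hk, EReal.coe_lt_coe_iff] at hlt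
        have hx := E.continuousAt_x (ha.trans_lt ht.1) (hltT _ ht.2)
        refine ⟨g (x tk) - g (x tj), Tendsto.congr' (f₁ := fun s => g (x s) - g (x tj)) ?_
          (((hg.continuousAt.comp hx).sub continuousAt_const).tendsto.mono_left
            nhdsWithin_le_nhds)⟩
        filter_upwards [Ioo_mem_nhdsLT hlt] with s hs
        refine (E.samplingError_eq htj hs.1.le ?_).symm
        rw [hk]
        exact EReal.coe_lt_coe_iff.2 hs.2
  · have hsub : Icc t₀ b ⊆ {t : ℝ | t₀ ≤ t ∧ (t : EReal) < T} := fun t ht =>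
      ⟨ht.1, (EReal.coe_le_coe_iff.2 ht.2).trans_lt hb⟩
    obtain ⟨M, hM⟩ := isCompact_Icc.exists_bound_of_continuousOn
      (hg.comp_continuousOn (E.continuousOn_x.mono hsub))
    refine ⟨M + M, fun t ht => ?_⟩
    obtain ⟨k, tk, hk, h0, hkt, htk⟩ := E.exists_piece (ha.trans ht.1) (hltT t ht.2)
    rw [E.samplingError_eq hk hkt htk]
    exact (norm_sub_le _ _).trans (add_le_add (hM t ⟨ha.trans ht.1, ht.2.le⟩)
      (hM tk ⟨h0, hkt.trans ht.2.le⟩))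

/-- An execution solves the perturbed closed loop whose external input is the sampling error. -/
theorem isPerturbedSolution (hg : Continuous g) {a b : ℝ} (ha : t₀ ≤ a) (hb : (b : EReal) < T) :
    IsPerturbedSolution q f g (samplingError g x τ) z x a b := by
  have hsub : ∀ t ∈ Ico a b, t₀ ≤ t ∧ (t : EReal) < T := fun t ht =>
    ⟨ha.trans ht.1, (EReal.coe_lt_coe_iff.2 ht.2).trans hb⟩
  have hpiece : ∀ t ∈ Ico a b,
      HasDerivWithinAt z (q (z t, x t, g (x t) - samplingError g x τ t)) (Ici t) t ∧
      HasDerivWithinAt x (f (z t, x t, g (x t) - samplingError g x τ t)) (Ici t) t := by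
    intro t ht
    obtain ⟨k, tk, hk, h0, hkt, htk⟩ := E.exists_piece (hsub t ht).1 (hsub t ht).2
    rw [E.samplingError_eq hk hkt htk, sub_sub_cancel]
    exact ⟨E.deriv_z k tk t hk hkt htk (hsub t ht).2, E.deriv_x k tk t hk hkt htk (hsub t ht).2⟩
  exact ⟨E.isAdmissibleInput hg ha hb, E.continuousOn_z.mono hsub, E.continuousOn_x.mono hsub,
    fun t ht => (hpiece t ht).1, fun t ht => (hpiece t ht).2⟩

/-- On a sampling interval the gain `γ̄` maps the sampling error below any bound for the auxiliary
output since the last sampling instant. -/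
theorem gain_samplingError_le (hf : Continuous f) (hg : ContDiff ℝ 1 g) (hγ : IsClassKInf γbar)
    {k : ℕ} {tk t Ξ : ℝ} (hk : τ k = tk) (hkt : tk ≤ t) (ht : (t : EReal) < τ (k + 1))
    (htT : (t : EReal) < T) (hΞ0 : 0 ≤ Ξ) (hΞ : ∀ σ ∈ Ioc tk t, ‖auxOutput g x σ‖ ≤ Ξ) :
    γbar ‖samplingError g x τ t‖ ≤ Ξ := by
  obtain ⟨b, htb, -, -, hH⟩ := E.exists_isHoldSolution hk ht htT
  rcases hkt.eq_or_lt with rfl | hlt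
  · rw [E.samplingError_eq hk le_rfl ht, sub_self, norm_zero, hγ.zero]
    exact hΞ0
  · refine le_trans (hγ.mono (norm_nonneg _) ?_) (gain_supNorm_le_of_not_triggered hγ hlt hΞ0 hΞ
      (E.not_triggered hk hlt ht htT))
    rw [E.samplingError_eq hk hkt ht, ← hH.auxInput_eq hf hg ⟨hkt, htb⟩]
    exact ContinuousOn.le_supNorm ((hH.continuousOn_auxInput hf hg).mono
      fun σ hσ => ⟨hσ.1, hσ.2.trans_lt htb⟩) ⟨hkt, le_rfl⟩

/-- A bound for the auxiliary output yields a positive lower bound for the time between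
samplings. -/
theorem exists_dwell_time (hγ : IsClassKInf γbar) {C : ℝ}
    (hC : Tendsto (fun s => γbar s / s) (𝓝[>] 0) (𝓝 C)) {Ξ : ℝ} (hΞ0 : 0 ≤ Ξ)
    (hΞ : ∀ t : ℝ, t₀ < t → (t : EReal) < T → ‖auxOutput g x t‖ ≤ Ξ) :
    ∃ h : ℝ, 0 < h ∧ ∀ k, τ k + (h : EReal) ≤ τ (k + 1) := by
  obtain ⟨d, hd, hdm⟩ := hγ.exists_mul_le hC Ξ
  refine ⟨min 1 d, lt_min one_pos hd, fun k => ?_⟩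
  by_cases hk : τ k = ⊤
  · rw [E.sample_succ, hk, nextSample_top]
    exact le_top
  · obtain ⟨tk, htk, h0⟩ := E.exists_real hk
    rw [E.sample_succ, htk, ← EReal.coe_add]
    refine le_nextSample_of_forall fun t hkt htT hlt => ?_
    have hlt' : t - tk < min 1 d := by
      have := EReal.coe_lt_coe_iff.1 hlt
      linarith
    exact not_triggered_of_sub_lt hγ hkt hΞ0 (fun σ hσ => hΞ σ (h0.trans_lt hσ.1)
      ((EReal.coe_le_coe_iff.2 hσ.2).trans_lt htT)) hdm (hlt'.le.trans (min_le_left _ _))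
      (hlt'.trans_le (min_le_right _ _))

end IsExecution

end Execution

/-! ### A priori bounds along executions -/

section APriori

variable {p n m : ℕ}
  {q : EuclideanSpace ℝ (Fin p) × EuclideanSpace ℝ (Fin n) × EuclideanSpace ℝ (Fin m) →
    EuclideanSpace ℝ (Fin p)}
  {f : EuclideanSpace ℝ (Fin p) × EuclideanSpace ℝ (Fin n) × EuclideanSpace ℝ (Fin m) →
    EuclideanSpace ℝ (Fin n)}
  {g : EuclideanSpace ℝ (Fin n) → EuclideanSpace ℝ (Fin m)}
  {βz βx : ℝ → ℝ → ℝ} {γzx γzr γxz γxr γξz γξx γξr : ℝ → ℝ}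
  {z : ℝ → EuclideanSpace ℝ (Fin p)} {x : ℝ → EuclideanSpace ℝ (Fin n)}
  {γbar : ℝ → ℝ} {t₀ : ℝ} {T : EReal} {τ : ℕ → EReal}

/-- The standing assumptions: continuous data, the ISS and BSIBO estimates with their gains, the
small-gain condition, and a triggering gain `γ̄` that dominates the composite gain and has a limit
`γ̄(s) / s → C` at `0⁺`. -/
structure StandingAssumptions
    (q : EuclideanSpace ℝ (Fin p) × EuclideanSpace ℝ (Fin n) × EuclideanSpace ℝ (Fin m) →
      EuclideanSpace ℝ (Fin p))
    (f : EuclideanSpace ℝ (Fin p) × EuclideanSpace ℝ (Fin n) × EuclideanSpace ℝ (Fin m) →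
      EuclideanSpace ℝ (Fin n))
    (g : EuclideanSpace ℝ (Fin n) → EuclideanSpace ℝ (Fin m))
    (βz βx : ℝ → ℝ → ℝ) (γzx γzr γxz γxr γξz γξx γξr γbar : ℝ → ℝ) (C : ℝ) : Prop where
  hq : Continuous q
  hf : Continuous f
  hg : ContDiff ℝ 1 g
  hβz : IsClassKL βz
  hβx : IsClassKL βx
  hγzx : IsClassK γzx
  hγzr : IsClassK γzr
  hγxz : IsClassK γxz
  hγxr : IsClassK γxr
  hγξz : IsClassK γξz
  hγξx : IsClassK γξx
  hγξr : IsClassK γξr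
  issz : ISSz q f g βz γzx γzr
  issx : ISSx q f g βx γxz γxr
  bsibo : BSIBO q f g γξz γξx γξr
  small : ∀ s > 0, γzx (γxz s) < s
  hγbar : IsClassKInf γbar
  dom : ∀ s > 0, compositeGain γzx γzr γxz γxr γξz γξx γξr s < γbar s
  lim : Tendsto (fun s => γbar s / s) (𝓝[>] 0) (𝓝 C)

/-- A bound on `(a, b]` extends to `a` by right-continuity. -/
theorem norm_le_of_forall_Ioc {E : Type*} [NormedAddCommGroup E] {w : ℝ → E} {a b B : ℝ}
    (hw : ContinuousWithinAt w (Ici a) a) (hab : a < b) (h : ∀ t ∈ Ioc a b, ‖w t‖ ≤ B) :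
    ∀ t ∈ Icc a b, ‖w t‖ ≤ B := by
  intro t ht
  rcases ht.1.eq_or_lt with rfl | hlt
  · refine le_of_tendsto ((hw.mono Ioi_subset_Ici_self).norm) ?_
    filter_upwards [Ioc_mem_nhdsGT hab] with s hs using h s hs
  · exact h t ⟨hlt, ht.2⟩

/-- If `γ̄(R) ≤ max {c, γ(R)}`, then `γ̄(R) ≤ c`, because `γ < γ̄` away from zero. -/
theorem StandingAssumptions.gain_le {C c R : ℝ}
    (A : StandingAssumptions q f g βz βx γzx γzr γxz γxr γξz γξx γξr γbar C) (hc : 0 ≤ c)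
    (hR : 0 ≤ R) (h : γbar R ≤ max c (compositeGain γzx γzr γxz γxr γξz γξx γξr R)) :
    γbar R ≤ c := by
  rcases le_max_iff.1 h with h | h
  · exact h
  · rcases hR.eq_or_lt with rfl | hpos
    · rwa [A.hγbar.zero]
    · exact absurd (A.dom R hpos) (not_lt.2 h)

theorem IsClassKInf.gain_supNorm_le {E : Type*} [NormedAddCommGroup E] {w : ℝ → E} {a b B : ℝ}
    (hγ : IsClassKInf γbar) (hB : 0 ≤ B) (h : ∀ t ∈ Icc a b, γbar ‖w t‖ ≤ B) :
    γbar (supNorm w a b) ≤ B := by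
  obtain ⟨y, hy, rfl⟩ := hγ.exists_eq hB
  exact hγ.mono supNorm_nonneg (supNorm_le hy fun t ht =>
    hγ.le_of_le (norm_nonneg _) hy (h t ht))

namespace IsExecution

variable {C : ℝ} (E : IsExecution q f g γbar t₀ T τ z x)
  (A : StandingAssumptions q f g βz βx γzx γzr γxz γxr γξz γξx γξr γbar C)
include E A

theorem norm_z_le {a t X R : ℝ} (ha : t₀ ≤ a) (hat : a < t) (htT : (t : EReal) < T)
    (hX : ∀ s ∈ Icc a t, ‖x s‖ ≤ X) (hR : ∀ s ∈ Icc a t, ‖samplingError g x τ s‖ ≤ R) :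
    ‖z t‖ ≤ max (βz ‖z a‖ (t - a)) (max (γzx X) (γzr R)) := by
  obtain ⟨b, h1, h2⟩ := EReal.lt_iff_exists_real_btwn.1 htT
  have hmem : a ∈ Icc a t := ⟨le_rfl, hat.le⟩
  refine (A.issz a b _ z x (E.isPerturbedSolution A.hg.continuous ha h2) t
    ⟨hat, EReal.coe_lt_coe_iff.1 h1⟩).trans ?_
  gcongr
  · exact A.hγzx.mono supNorm_nonneg (supNorm_le ((norm_nonneg _).trans (hX a hmem)) hX)
  · exact A.hγzr.mono supNorm_nonneg (supNorm_le ((norm_nonneg _).trans (hR a hmem)) hR)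

theorem norm_x_le {a t Z R : ℝ} (ha : t₀ ≤ a) (hat : a < t) (htT : (t : EReal) < T)
    (hZ : ∀ s ∈ Icc a t, ‖z s‖ ≤ Z) (hR : ∀ s ∈ Icc a t, ‖samplingError g x τ s‖ ≤ R) :
    ‖x t‖ ≤ max (βx ‖x a‖ (t - a)) (max (γxz Z) (γxr R)) := by
  obtain ⟨b, h1, h2⟩ := EReal.lt_iff_exists_real_btwn.1 htT
  have hmem : a ∈ Icc a t := ⟨le_rfl, hat.le⟩
  refine (A.issx a b _ z x (E.isPerturbedSolution A.hg.continuous ha h2) t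
    ⟨hat, EReal.coe_lt_coe_iff.1 h1⟩).trans ?_
  gcongr
  · exact A.hγxz.mono supNorm_nonneg (supNorm_le ((norm_nonneg _).trans (hZ a hmem)) hZ)
  · exact A.hγxr.mono supNorm_nonneg (supNorm_le ((norm_nonneg _).trans (hR a hmem)) hR)

theorem norm_auxOutput_le {a t Z X R : ℝ} (ha : t₀ ≤ a) (hat : a < t) (htT : (t : EReal) < T)
    (hZ : ∀ s ∈ Icc a t, ‖z s‖ ≤ Z) (hX : ∀ s ∈ Icc a t, ‖x s‖ ≤ X)
    (hR : ∀ s ∈ Icc a t, ‖samplingError g x τ s‖ ≤ R) :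
    ‖auxOutput g x t‖ ≤ max (γξz Z) (max (γξx X) (γξr R)) := by
  obtain ⟨b, h1, h2⟩ := EReal.lt_iff_exists_real_btwn.1 htT
  have hmem : a ∈ Icc a t := ⟨le_rfl, hat.le⟩
  refine (A.bsibo a b _ z x (E.isPerturbedSolution A.hg.continuous ha h2) t
    ⟨hat, EReal.coe_lt_coe_iff.1 h1⟩).trans ?_
  gcongr
  · exact A.hγξz.mono supNorm_nonneg (supNorm_le ((norm_nonneg _).trans (hZ a hmem)) hZ)
  · exact A.hγξx.mono supNorm_nonneg (supNorm_le ((norm_nonneg _).trans (hX a hmem)) hX)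
  · exact A.hγξr.mono supNorm_nonneg (supNorm_le ((norm_nonneg _).trans (hR a hmem)) hR)

/-- The a priori bounds. Here `bz`, `bx` collect the transients from the initial state, and the
sampling error stays below `R`, the solution of `γ̄(R) = max {γ_ξ^z(bz), γ_ξ^x(bx)}`. -/
theorem a_priori {bz bx R : ℝ}
    (hbz : bz = max (βz ‖z t₀‖ 0) (γzx (βx ‖x t₀‖ 0)))
    (hbx : bx = max (βx ‖x t₀‖ 0) (γxz (βz ‖z t₀‖ 0)))
    (hR0 : 0 ≤ R) (hR : γbar R = max (γξz bz) (γξx bx)) {t : ℝ} (h0 : t₀ ≤ t)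
    (htT : (t : EReal) < T) :
    ‖samplingError g x τ t‖ ≤ R ∧ ‖z t‖ ≤ max bz (barGainZ γzx γzr γxr R) ∧
      ‖x t‖ ≤ max bx (barGainX γxz γxr γzr R) ∧
      (t₀ < t → ‖auxOutput g x t‖ ≤
        max (max (γξz bz) (γξx bx)) (compositeGain γzx γzr γxz γxr γξz γξx γξr R)) := by
  obtain ⟨t₁, h1, h1T⟩ := EReal.lt_iff_exists_real_btwn.1 htT
  have htt₁ : t < t₁ := EReal.coe_lt_coe_iff.1 h1
  have h01 : t₀ < t₁ := h0.trans_lt htt₁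
  have hltT : ∀ s ≤ t₁, (s : EReal) < T := fun s hs => (EReal.coe_le_coe_iff.2 hs).trans_lt h1T
  have hsub : Icc t₀ t₁ ⊆ {t : ℝ | t₀ ≤ t ∧ (t : EReal) < T} := fun s hs => ⟨hs.1, hltT s hs.2⟩
  have hβz0 := A.hβz.nonneg (norm_nonneg (z t₀)) le_rfl
  have hβx0 := A.hβx.nonneg (norm_nonneg (x t₀)) le_rfl
  have hbz0 : 0 ≤ bz := hbz ▸ le_max_of_le_left hβz0
  have hbx0 : 0 ≤ bx := hbx ▸ le_max_of_le_left hβx0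
  have hc0 : 0 ≤ max (γξz bz) (γξx bx) := le_max_of_le_left (A.hγξz.nonneg hbz0)
  have hz : ∀ s ∈ Icc t₀ t₁, ‖z s‖ ≤ supNorm z t₀ t₁ := fun s hs =>
    ContinuousOn.le_supNorm (E.continuousOn_z.mono hsub) hs
  have hx : ∀ s ∈ Icc t₀ t₁, ‖x s‖ ≤ supNorm x t₀ t₁ := fun s hs =>
    ContinuousOn.le_supNorm (E.continuousOn_x.mono hsub) hs
  have hr : ∀ s ∈ Icc t₀ t₁, ‖samplingError g x τ s‖ ≤ supNorm (samplingError g x τ) t₀ t₁ := by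
    -- an admissible input is bounded on half-open intervals, hence a slightly larger one is used
    obtain ⟨t₂, h2, h2T⟩ := EReal.lt_iff_exists_real_btwn.1 h1T
    obtain ⟨M, hM⟩ := (E.isAdmissibleInput A.hg.continuous le_rfl h2T).bounded
    exact fun s hs => le_supNorm
      (fun u hu => hM u ⟨hu.1, hu.2.trans_lt (EReal.coe_lt_coe_iff.1 h2)⟩) hs
  set Z := supNorm z t₀ t₁ with hZdef
  set X := supNorm x t₀ t₁ with hXdef
  set R₁ := supNorm (samplingError g x τ) t₀ t₁ with hR₁def
  have hZ0 : 0 ≤ Z := supNorm_nonneg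
  have hX0 : 0 ≤ X := supNorm_nonneg
  have hR₁0 : 0 ≤ R₁ := supNorm_nonneg
  have hmem : ∀ s ∈ Ioc t₀ t₁, Icc t₀ s ⊆ Icc t₀ t₁ := fun s hs => Icc_subset_Icc_right hs.2
  have hright : ∀ᶠ s in 𝓝[≥] t₀, s ∈ {t : ℝ | t₀ ≤ t ∧ (t : EReal) < T} :=
    mem_of_superset (Icc_mem_nhdsGE h01) hsub
  have hZle : Z ≤ max (βz ‖z t₀‖ 0) (max (γzx X) (γzr R₁)) := by
    refine supNorm_le (le_max_of_le_left hβz0) (norm_le_of_forall_Ioc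
      ((E.continuousOn_z t₀ ⟨le_rfl, E.start_lt⟩).mono_of_mem_nhdsWithin hright) h01
      fun s hs => ?_)
    refine (E.norm_z_le A le_rfl hs.1 (hltT s hs.2) (fun u hu => hx u (hmem s hs hu))
      (fun u hu => hr u (hmem s hs hu))).trans ?_
    gcongr
    exact A.hβz.le_zero (norm_nonneg _) (sub_nonneg.2 hs.1.le)
  have hXle : X ≤ max (βx ‖x t₀‖ 0) (max (γxz Z) (γxr R₁)) := by
    refine supNorm_le (le_max_of_le_left hβx0) (norm_le_of_forall_Ioc
      ((E.continuousOn_x t₀ ⟨le_rfl, E.start_lt⟩).mono_of_mem_nhdsWithin hright) h01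
      fun s hs => ?_)
    refine (E.norm_x_le A le_rfl hs.1 (hltT s hs.2) (fun u hu => hz u (hmem s hs hu))
      (fun u hu => hr u (hmem s hs hu))).trans ?_
    gcongr
    exact A.hβx.le_zero (norm_nonneg _) (sub_nonneg.2 hs.1.le)
  have hZ1 : Z ≤ max bz (barGainZ γzx γzr γxr R₁) :=
    hbz ▸ small_gain A.hγzx A.small hZ0 hβx0 hZle hXle hX0
  have hX1 : X ≤ max bx (barGainX γxz γxr γzr R₁) :=
    hbx ▸ small_gain A.hγxz (small_gain_symm A.hγzx A.small) hX0 hβz0 hXle hZle hZ0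
  have hξ : ∀ s ∈ Ioc t₀ t₁, ‖auxOutput g x s‖ ≤
      max (max (γξz bz) (γξx bx)) (compositeGain γzx γzr γxz γxr γξz γξx γξr R₁) := by
    intro s hs
    refine (E.norm_auxOutput_le A le_rfl hs.1 (hltT s hs.2) (fun u hu => hz u (hmem s hs hu))
      (fun u hu => hx u (hmem s hs hu)) (fun u hu => hr u (hmem s hs hu))).trans ?_
    refine max_le ?_ (max_le ?_ ?_)
    · rcases le_max_iff.1 hZ1 with h | h
      · exact le_max_of_le_left (le_max_of_le_left (A.hγξz.mono hZ0 h))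
      · exact le_max_of_le_right (le_max_of_le_left (A.hγξz.mono hZ0 h))
    · rcases le_max_iff.1 hX1 with h | h
      · exact le_max_of_le_left (le_max_of_le_right (A.hγξx.mono hX0 h))
      · exact le_max_of_le_right (le_max_of_le_right (le_max_of_le_left (A.hγξx.mono hX0 h)))
    · exact le_max_of_le_right (le_max_of_le_right (le_max_right _ _))
  have hloop : γbar R₁ ≤
      max (max (γξz bz) (γξx bx)) (compositeGain γzx γzr γxz γxr γξz γξx γξr R₁) := by
    refine A.hγbar.gain_supNorm_le (le_max_of_le_left hc0) fun s hs => ?_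
    obtain ⟨k, tk, hk, h0k, hks, hsk⟩ := E.exists_piece hs.1 (hltT s hs.2)
    exact E.gain_samplingError_le A.hf A.hg A.hγbar hk hks hsk (hltT s hs.2)
      (le_max_of_le_left hc0) fun σ hσ => hξ σ ⟨h0k.trans_lt hσ.1, hσ.2.trans hs.2⟩
  have hRR : R₁ ≤ R :=
    A.hγbar.le_of_le hR₁0 hR0 ((A.gain_le hc0 hR₁0 hloop).trans hR.ge)
  have hbgz := barGainZ_mono A.hγzx A.hγzr A.hγxr hR₁0 hRR
  have hbgx : barGainX γxz γxr γzr R₁ ≤ barGainX γxz γxr γzr R :=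
    barGainZ_mono A.hγxz A.hγxr A.hγzr hR₁0 hRR
  have ht : t ∈ Icc t₀ t₁ := ⟨h0, htt₁.le⟩
  refine ⟨(hr t ht).trans hRR, (hz t ht).trans (hZ1.trans (max_le_max le_rfl hbgz)),
    (hx t ht).trans (hX1.trans (max_le_max le_rfl hbgx)), fun hlt => (hξ t ⟨hlt, htt₁.le⟩).trans
      (max_le_max le_rfl ?_)⟩
  refine max_le_max (A.hγξz.mono ?_ hbgz) (max_le_max (A.hγξx.mono ?_ hbgx)
    (A.hγξr.mono hR₁0 hRR))
  · exact barGainZ_nonneg A.hγzr hR₁0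
  · exact barGainZ_nonneg A.hγxr hR₁0

/-- All signals are bounded along an execution. -/
theorem exists_bound : ∃ M, 0 ≤ M ∧ ∀ t : ℝ, t₀ ≤ t → (t : EReal) < T →
    ‖samplingError g x τ t‖ ≤ M ∧ ‖z t‖ ≤ M ∧ ‖x t‖ ≤ M ∧ (t₀ < t → ‖auxOutput g x t‖ ≤ M) := by
  obtain ⟨bz, hbz⟩ : ∃ b, b = max (βz ‖z t₀‖ 0) (γzx (βx ‖x t₀‖ 0)) := ⟨_, rfl⟩
  obtain ⟨bx, hbx⟩ : ∃ b, b = max (βx ‖x t₀‖ 0) (γxz (βz ‖z t₀‖ 0)) := ⟨_, rfl⟩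
  have hbz0 : 0 ≤ bz := hbz ▸ le_max_of_le_left (A.hβz.nonneg (norm_nonneg _) le_rfl)
  obtain ⟨R, hR0, hR⟩ := A.hγbar.exists_eq (le_max_of_le_left (A.hγξz.nonneg hbz0) :
    0 ≤ max (γξz bz) (γξx bx))
  refine ⟨max R (max (max bz (barGainZ γzx γzr γxr R)) (max (max bx (barGainX γxz γxr γzr R))
    (max (max (γξz bz) (γξx bx)) (compositeGain γzx γzr γxz γxr γξz γξx γξr R)))),
    le_max_of_le_left hR0, fun t h0 htT => ?_⟩
  obtain ⟨h1, h2, h3, h4⟩ := E.a_priori A hbz hbx hR0 hR h0 htT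
  exact ⟨h1.trans (le_max_left _ _), h2.trans (le_max_of_le_right (le_max_left _ _)),
    h3.trans (le_max_of_le_right (le_max_of_le_right (le_max_left _ _))),
    fun h => (h4 h).trans (le_max_of_le_right (le_max_of_le_right (le_max_right _ _)))⟩

end IsExecution

end APriori

/-! ### Extensions of executions -/

section Extension

variable {p n m : ℕ}
  {q : EuclideanSpace ℝ (Fin p) × EuclideanSpace ℝ (Fin n) × EuclideanSpace ℝ (Fin m) →
    EuclideanSpace ℝ (Fin p)}
  {f : EuclideanSpace ℝ (Fin p) × EuclideanSpace ℝ (Fin n) × EuclideanSpace ℝ (Fin m) →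
    EuclideanSpace ℝ (Fin n)}
  {g : EuclideanSpace ℝ (Fin n) → EuclideanSpace ℝ (Fin m)}
  {z z' : ℝ → EuclideanSpace ℝ (Fin p)} {x x' : ℝ → EuclideanSpace ℝ (Fin n)}
  {γbar : ℝ → ℝ} {t₀ : ℝ} {T T' : EReal} {τ τ' : ℕ → EReal}

/-- `w'` agrees with `w` on `[t₀, T)`. -/
def AgreeUntil {E : Type*} (t₀ : ℝ) (T : EReal) (w w' : ℝ → E) : Prop :=
  ∀ t : ℝ, t₀ ≤ t → (t : EReal) < T → w' t = w t

theorem AgreeUntil.eventuallyEq {E : Type*} {w w' : ℝ → E} (h : AgreeUntil t₀ T w w') {t : ℝ}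
    (h0 : t₀ ≤ t) (htT : (t : EReal) < T) : w' =ᶠ[𝓝[≥] t] w := by
  have hU : IsOpen {s : ℝ | (s : EReal) < T} :=
    isOpen_lt continuous_coe_real_ereal continuous_const
  filter_upwards [self_mem_nhdsWithin, mem_nhdsWithin_of_mem_nhds (hU.mem_nhds htT)] with s h1 h2
  exact h s (h0.trans h1) h2

theorem AgreeUntil.continuousWithinAt {E : Type*} [TopologicalSpace E] {w w' : ℝ → E}
    (h : AgreeUntil t₀ T w w') {t : ℝ} (h0 : t₀ ≤ t) (htT : (t : EReal) < T)
    (hw : ContinuousOn w {t : ℝ | t₀ ≤ t ∧ (t : EReal) < T}) :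
    ContinuousWithinAt w' {t : ℝ | t₀ ≤ t ∧ (t : EReal) < T'} t := by
  have hU : IsOpen {s : ℝ | (s : EReal) < T} :=
    isOpen_lt continuous_coe_real_ereal continuous_const
  refine ((hw.congr fun s hs => h s hs.1 hs.2) t ⟨h0, htT⟩).mono_of_mem_nhdsWithin ?_
  filter_upwards [self_mem_nhdsWithin, mem_nhdsWithin_of_mem_nhds (hU.mem_nhds htT)] with s h1 h2
  exact ⟨h1.1, h2⟩

theorem AgreeUntil.triggered_iff (h : AgreeUntil t₀ T x x') {s t : ℝ} (hs : t₀ ≤ s)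
    (htT : (t : EReal) ≤ T) : Triggered g γbar x s t ↔ Triggered g γbar x' s t :=
  triggered_congr (fun σ hσ => (h σ hσ.1 ((EReal.coe_lt_coe_iff.2 hσ.2).trans_le htT)).symm) hs
    le_rfl

theorem AgreeUntil.nextSample_le (h : AgreeUntil t₀ T x x') (hTT : T ≤ T') {s : ℝ} (hs : t₀ ≤ s) :
    nextSample g γbar x' T' s ≤ nextSample g γbar x T s := by
  refine le_sInf ?_
  rintro _ ⟨tk, t, hst, rfl, h1, h2, h3⟩
  obtain rfl := EReal.coe_injective hst
  exact EventTriggered.nextSample_le h1 (h2.trans_le hTT) ((h.triggered_iff hs h2.le).1 h3)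

theorem AgreeUntil.nextSample_eq (h : AgreeUntil t₀ T x x') (hTT : T ≤ T') {s : ℝ} (hs : t₀ ≤ s)
    (hlt : nextSample g γbar x' T' s < T) :
    nextSample g γbar x T s = nextSample g γbar x' T' s := by
  refine le_antisymm (le_sInf ?_) (h.nextSample_le hTT hs)
  have key : ∀ t : ℝ, s < t → (t : EReal) < T → Triggered g γbar x' s t →
      nextSample g γbar x T s ≤ t := fun t h1 h2 h3 =>
    EventTriggered.nextSample_le h1 h2 ((h.triggered_iff hs h2.le).2 h3)
  rintro _ ⟨tk, t, hst, rfl, h1, h2, h3⟩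
  obtain rfl := EReal.coe_injective hst
  rcases lt_or_ge (t : EReal) T with htT | htT
  · exact key t h1 htT h3
  · obtain ⟨_, ⟨tk', t', hst', rfl, h1', h2', h3'⟩, hσ⟩ := sInf_lt_iff.1 hlt
    obtain rfl := EReal.coe_injective hst'
    exact (key t' h1' hσ h3').trans (hσ.le.trans htT)

namespace IsExecution

variable (E : IsExecution q f g γbar t₀ T τ z x) (hTT : T ≤ T')
  (hx : AgreeUntil t₀ T x x') (h0 : τ' 0 = t₀)
  (hsucc : ∀ k, τ' (k + 1) = nextSample g γbar x' T' (τ' k))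
include E hTT hx h0 hsucc

/-- The sampling instants of an extension that lie before `T` are those of the execution. -/
theorem sample_eq_of_lt : ∀ k, τ' k < T → τ k = τ' k := by
  intro k
  induction k with
  | zero => intro; rw [h0, E.sample_zero]
  | succ k ih =>
    intro hlt
    have hk : τ' k < T := lt_of_le_of_lt (hsucc k ▸ le_nextSample _) hlt
    obtain ⟨tk, htk, h0k⟩ := E.exists_real (k := k) (ih hk ▸ hk.ne_top)
    rw [hsucc, ← ih hk, htk] at hlt
    rw [E.sample_succ, hsucc, ← ih hk, htk]
    exact hx.nextSample_eq hTT h0k hlt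

/-- An extension has all sampling instants of the execution. -/
theorem sample_eq_of_ne_top : ∀ k, τ k ≠ ⊤ → τ' k = τ k := by
  intro k
  induction k with
  | zero => intro; rw [h0, E.sample_zero]
  | succ k ih =>
    intro hne
    have hk : τ k ≠ ⊤ := ne_top_of_le_ne_top hne (E.monotone k.le_succ)
    obtain ⟨tk, htk, h0k⟩ := E.exists_real hk
    have hlt := E.lt_of_ne_top hne
    rw [E.sample_succ, htk] at hlt
    rw [E.sample_succ, hsucc, ih hk, htk]
    exact (hx.nextSample_eq hTT h0k ((hx.nextSample_le hTT h0k).trans_lt hlt)).symm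

theorem le_iSup_sample : T ≤ ⨆ k, τ' k := by
  by_contra! hlt
  have hall : ∀ k, τ k = τ' k := fun k =>
    E.sample_eq_of_lt hTT hx h0 hsucc k ((le_iSup τ' k).trans_lt hlt)
  have := E.covered
  rw [iSup_congr hall] at this
  exact absurd hlt (not_lt.2 this)

/-- Before `T`, an extension satisfies the differential equations with its own samples. -/
theorem hasDerivWithinAt_of_agree (hz : AgreeUntil t₀ T z z') {k : ℕ} {tk t : ℝ}
    (hk : τ' k = tk) (hkt : tk ≤ t) (ht : (t : EReal) < τ' (k + 1)) (htT : (t : EReal) < T) :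
    HasDerivWithinAt z' (q (z' t, x' t, g (x' tk))) (Ici t) t ∧
      HasDerivWithinAt x' (f (z' t, x' t, g (x' tk))) (Ici t) t := by
  have hkT : τ' k < T := by rw [hk]; exact (EReal.coe_le_coe_iff.2 hkt).trans_lt htT
  have hk' : τ k = tk := (E.sample_eq_of_lt hTT hx h0 hsucc k hkT).trans hk
  have h0k : t₀ ≤ tk := by have := E.start_le k; rwa [hk', EReal.coe_le_coe_iff] at this
  have ht' : (t : EReal) < τ (k + 1) := by
    by_cases h : τ (k + 1) = ⊤
    · rw [h]; exact EReal.coe_lt_top t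
    · rwa [← E.sample_eq_of_ne_top hTT hx h0 hsucc _ h]
  have h0t := h0k.trans hkt
  rw [hz t h0t htT, hx t h0t htT, hx tk h0k ((EReal.coe_le_coe_iff.2 hkt).trans_lt htT)]
  exact ⟨(E.deriv_z k tk t hk' hkt ht' htT).congr_of_eventuallyEq (hz.eventuallyEq h0t htT)
      (hz t h0t htT),
    (E.deriv_x k tk t hk' hkt ht' htT).congr_of_eventuallyEq (hx.eventuallyEq h0t htT)
      (hx t h0t htT)⟩

end IsExecution

/-- The sampling instants generated by a trajectory. -/
noncomputable def sampleSeq (g : EuclideanSpace ℝ (Fin n) → EuclideanSpace ℝ (Fin m))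
    (γbar : ℝ → ℝ) (x : ℝ → EuclideanSpace ℝ (Fin n)) (t₀ : ℝ) (T : EReal) (k : ℕ) : EReal :=
  (nextSample g γbar x T)^[k] t₀

theorem sampleSeq_zero : sampleSeq g γbar x t₀ T 0 = t₀ := rfl

theorem sampleSeq_succ (k : ℕ) :
    sampleSeq g γbar x t₀ T (k + 1) = nextSample g γbar x T (sampleSeq g γbar x t₀ T k) :=
  Function.iterate_succ_apply' _ _ _

/-! ### Existence of maximal executions -/

theorem exists_isExecution {C : ℝ} (hq : Continuous q) (hf : Continuous f) (hg : ContDiff ℝ 1 g)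
    (hγ : IsClassKInf γbar) (hC : Tendsto (fun s => γbar s / s) (𝓝[>] 0) (𝓝 C)) (t₀ : ℝ)
    (z₀ : EuclideanSpace ℝ (Fin p)) (x₀ : EuclideanSpace ℝ (Fin n)) :
    ∃ T τ z x, IsExecution q f g γbar t₀ T τ z x ∧ z t₀ = z₀ ∧ x t₀ = x₀ := by
  obtain ⟨δ, hδ, z, x, hH, hz0, hx0⟩ := exists_isHoldSolution hq hf (g x₀) t₀ z₀ x₀
  obtain ⟨b, hb, hnt⟩ := hH.exists_forall_not_triggered hf hg hγ hC (by linarith)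
  replace hH := hH.mono le_rfl hb.2
  rw [← hx0] at hH
  have h1 : sampleSeq g γbar x t₀ b 1 = ⊤ := by
    rw [sampleSeq_succ, sampleSeq_zero]
    exact nextSample_eq_top fun t h1 h2 => hnt t ⟨h1, EReal.coe_lt_coe_iff.1 h2⟩
  have hset : {t : ℝ | t₀ ≤ t ∧ (t : EReal) < b} = Ico t₀ b := by
    ext t; simp
  have hpiece : ∀ (k : ℕ) (tk : ℝ), sampleSeq g γbar x t₀ b k = (tk : EReal) → tk = t₀ := by
    intro k tk hk
    cases k with
    | zero => exact (EReal.coe_injective hk).symm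
    | succ k =>
      have hmono : Monotone (sampleSeq g γbar x t₀ b) :=
        monotone_nat_of_le_succ fun k => sampleSeq_succ (x := x) k ▸ le_nextSample _
      have := hmono (Nat.le_add_left 1 k)
      rw [h1, hk] at this
      exact absurd (top_le_iff.1 this) (EReal.coe_ne_top _)
  refine ⟨b, sampleSeq g γbar x t₀ b, z, x, ⟨EReal.coe_lt_coe_iff.2 hb.1, rfl, sampleSeq_succ, ?_,
    hset ▸ hH.continuousOn_z, hset ▸ hH.continuousOn_x, ?_, ?_⟩, hz0, hx0⟩
  · exact le_top.trans (h1 ▸ le_iSup (sampleSeq g γbar x t₀ b) 1)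
  · intro k tk t hk hkt _ htT
    obtain rfl := hpiece k tk hk
    exact hH.deriv_z t ⟨hkt, EReal.coe_lt_coe_iff.1 htT⟩
  · intro k tk t hk hkt _ htT
    obtain rfl := hpiece k tk hk
    exact hH.deriv_x t ⟨hkt, EReal.coe_lt_coe_iff.1 htT⟩

/-- A family of executions from the same initial state, totally ordered by extension, has a common
extension. -/
theorem exists_common_extension {ι : Type*} [Nonempty ι] {t₀ : ℝ} (T : ι → EReal)
    (τ : ι → ℕ → EReal) (z : ι → ℝ → EuclideanSpace ℝ (Fin p))
    (x : ι → ℝ → EuclideanSpace ℝ (Fin n))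
    (hE : ∀ i, IsExecution q f g γbar t₀ (T i) (τ i) (z i) (x i))
    (hagree : ∀ i j (t : ℝ), t₀ ≤ t → (t : EReal) < T i → (t : EReal) < T j →
      z i t = z j t ∧ x i t = x j t) :
    ∃ T' τ' z' x', IsExecution q f g γbar t₀ T' τ' z' x' ∧
      ∀ i, T i ≤ T' ∧ AgreeUntil t₀ (T i) (z i) z' ∧ AgreeUntil t₀ (T i) (x i) x' := by
  classical
  let i₀ : ι := Classical.arbitrary ι
  have hsel : ∀ t : ℝ, ∃ j, ∀ i, (t : EReal) < T i → (t : EReal) < T j := by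
    intro t
    by_cases h : ∃ j, (t : EReal) < T j
    · exact ⟨h.choose, fun _ _ => h.choose_spec⟩
    · exact ⟨i₀, fun i hi => absurd ⟨i, hi⟩ h⟩
  choose j hj using hsel
  let z' : ℝ → EuclideanSpace ℝ (Fin p) := fun t => z (j t) t
  let x' : ℝ → EuclideanSpace ℝ (Fin n) := fun t => x (j t) t
  have hz : ∀ i, AgreeUntil t₀ (T i) (z i) z' := fun i t h0 ht =>
    (hagree _ _ t h0 (hj t i ht) ht).1
  have hx : ∀ i, AgreeUntil t₀ (T i) (x i) x' := fun i t h0 ht =>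
    (hagree _ _ t h0 (hj t i ht) ht).2
  have hle : ∀ i, T i ≤ ⨆ i, T i := le_iSup T
  have hder : ∀ (k : ℕ) (tk t : ℝ), sampleSeq g γbar x' t₀ (⨆ i, T i) k = tk → tk ≤ t →
      (t : EReal) < sampleSeq g γbar x' t₀ (⨆ i, T i) (k + 1) → (t : EReal) < ⨆ i, T i →
      HasDerivWithinAt z' (q (z' t, x' t, g (x' tk))) (Ici t) t ∧
      HasDerivWithinAt x' (f (z' t, x' t, g (x' tk))) (Ici t) t := by
    intro k tk t hk hkt ht htT
    obtain ⟨i, hi⟩ := lt_iSup_iff.1 htT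
    exact (hE i).hasDerivWithinAt_of_agree (hle i) (hx i) sampleSeq_zero sampleSeq_succ (hz i)
      hk hkt ht hi
  refine ⟨⨆ i, T i, sampleSeq g γbar x' t₀ (⨆ i, T i), z', x',
    ⟨(hE i₀).start_lt.trans_le (hle i₀), rfl, sampleSeq_succ, ?_, ?_, ?_,
      fun k tk t h1 h2 h3 h4 => (hder k tk t h1 h2 h3 h4).1,
      fun k tk t h1 h2 h3 h4 => (hder k tk t h1 h2 h3 h4).2⟩, fun i => ⟨hle i, hz i, hx i⟩⟩
  · exact iSup_le fun i => (hE i).le_iSup_sample (hle i) (hx i) sampleSeq_zero sampleSeq_succ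
  · rintro t ⟨h0, htT⟩
    obtain ⟨i, hi⟩ := lt_iSup_iff.1 htT
    exact (hz i).continuousWithinAt h0 hi (hE i).continuousOn_z
  · rintro t ⟨h0, htT⟩
    obtain ⟨i, hi⟩ := lt_iSup_iff.1 htT
    exact (hx i).continuousWithinAt h0 hi (hE i).continuousOn_x

/-- By Zorn's lemma, every initial state admits a maximal execution. -/
theorem exists_isMaximalExecution {C : ℝ} (hq : Continuous q) (hf : Continuous f)
    (hg : ContDiff ℝ 1 g) (hγ : IsClassKInf γbar)
    (hC : Tendsto (fun s => γbar s / s) (𝓝[>] 0) (𝓝 C)) (t₀ : ℝ)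
    (z₀ : EuclideanSpace ℝ (Fin p)) (x₀ : EuclideanSpace ℝ (Fin n)) :
    ∃ T τ z x, IsMaximalExecution q f g γbar t₀ T τ z x ∧ z t₀ = z₀ ∧ x t₀ = x₀ := by
  let S := {e : EReal × (ℕ → EReal) × (ℝ → EuclideanSpace ℝ (Fin p)) ×
    (ℝ → EuclideanSpace ℝ (Fin n)) //
    IsExecution q f g γbar t₀ e.1 e.2.1 e.2.2.1 e.2.2.2 ∧ e.2.2.1 t₀ = z₀ ∧ e.2.2.2 t₀ = x₀}
  let r : S → S → Prop := fun a b => a.1.1 ≤ b.1.1 ∧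
    AgreeUntil t₀ a.1.1 a.1.2.2.1 b.1.2.2.1 ∧ AgreeUntil t₀ a.1.1 a.1.2.2.2 b.1.2.2.2
  obtain ⟨T₁, τ₁, z₁, x₁, h₁, hz₁, hx₁⟩ := exists_isExecution hq hf hg hγ hC t₀ z₀ x₀
  have : Nonempty S := ⟨⟨(T₁, τ₁, z₁, x₁), h₁, hz₁, hx₁⟩⟩
  have htrans : ∀ {a b c : S}, r a b → r b c → r a c := by
    intro a b c hab hbc
    refine ⟨hab.1.trans hbc.1, fun t h0 ht => ?_, fun t h0 ht => ?_⟩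
    · exact (hbc.2.1 t h0 (ht.trans_le hab.1)).trans (hab.2.1 t h0 ht)
    · exact (hbc.2.2 t h0 (ht.trans_le hab.1)).trans (hab.2.2 t h0 ht)
  have hchain : ∀ c : Set S, IsChain r c → c.Nonempty → ∃ ub, ∀ a ∈ c, r a ub := by
    intro c hc hne
    have : Nonempty c := hne.to_subtype
    have hagree : ∀ (i j : c) (t : ℝ), t₀ ≤ t → (t : EReal) < i.1.1.1 → (t : EReal) < j.1.1.1 →
        i.1.1.2.2.1 t = j.1.1.2.2.1 t ∧ i.1.1.2.2.2 t = j.1.1.2.2.2 t := by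
      rintro ⟨a, ha⟩ ⟨b, hb⟩ t h0 hta htb
      rcases eq_or_ne a b with rfl | hab
      · exact ⟨rfl, rfl⟩
      rcases hc ha hb hab with h | h
      · exact ⟨(h.2.1 t h0 hta).symm, (h.2.2 t h0 hta).symm⟩
      · exact ⟨h.2.1 t h0 htb, h.2.2 t h0 htb⟩
    obtain ⟨T', τ', z', x', hE', hext⟩ := exists_common_extension (ι := c) (fun i => i.1.1.1)
      (fun i => i.1.1.2.1) (fun i => i.1.1.2.2.1) (fun i => i.1.1.2.2.2) (fun i => i.1.2.1) hagree
    obtain ⟨i⟩ := this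
    have hi := hext i
    exact ⟨⟨(T', τ', z', x'), hE', (hi.2.1 t₀ le_rfl i.1.2.1.start_lt).trans i.1.2.2.1,
      (hi.2.2 t₀ le_rfl i.1.2.1.start_lt).trans i.1.2.2.2⟩, fun a ha => hext ⟨a, ha⟩⟩
  obtain ⟨e, he⟩ := exists_maximal_of_nonempty_chains_bounded hchain htrans
  obtain ⟨⟨T, τ, z, x⟩, hE, hz, hx⟩ := e
  refine ⟨T, τ, z, x, ⟨hE, fun T' τ' z' x' hE' hagree => ?_⟩, hz, hx⟩
  by_contra! hlt
  have h0 := hagree t₀ le_rfl hE.start_lt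
  have := he ⟨(T', τ', z', x'), hE', h0.1.trans hz, h0.2.trans hx⟩
    ⟨hlt.le, fun t h1 h2 => (hagree t h1 h2).1, fun t h1 h2 => (hagree t h1 h2).2⟩
  exact absurd this.1 (not_le.2 hlt)

end Extension

/-! ### Continuation beyond a finite life time -/

section Continuation

variable {p n m : ℕ}
  {q : EuclideanSpace ℝ (Fin p) × EuclideanSpace ℝ (Fin n) × EuclideanSpace ℝ (Fin m) →
    EuclideanSpace ℝ (Fin p)}
  {f : EuclideanSpace ℝ (Fin p) × EuclideanSpace ℝ (Fin n) × EuclideanSpace ℝ (Fin m) →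
    EuclideanSpace ℝ (Fin n)}
  {g : EuclideanSpace ℝ (Fin n) → EuclideanSpace ℝ (Fin m)}
  {z z' : ℝ → EuclideanSpace ℝ (Fin p)} {x x' : ℝ → EuclideanSpace ℝ (Fin n)}
  {v : EuclideanSpace ℝ (Fin m)}
  {γbar : ℝ → ℝ} {t₀ T b : ℝ} {τ τ' : ℕ → EReal}

/-- `(z', x')` continues `(z, x)` from `[t₀, T)` to `[t₀, b)` as a continuous curve. -/
structure IsContinuation (t₀ T b : ℝ) (z : ℝ → EuclideanSpace ℝ (Fin p))
    (x : ℝ → EuclideanSpace ℝ (Fin n)) (z' : ℝ → EuclideanSpace ℝ (Fin p))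
    (x' : ℝ → EuclideanSpace ℝ (Fin n)) : Prop where
  agree_z : AgreeUntil t₀ T z z'
  agree_x : AgreeUntil t₀ T x x'
  continuousOn_z : ContinuousOn z' (Ico t₀ b)
  continuousOn_x : ContinuousOn x' (Ico t₀ b)

theorem IsContinuation.mono (h : IsContinuation t₀ T b z x z' x') {b' : ℝ} (hb : b' ≤ b) :
    IsContinuation t₀ T b' z x z' x' :=
  ⟨h.agree_z, h.agree_x, h.continuousOn_z.mono (Ico_subset_Ico_right hb),
    h.continuousOn_x.mono (Ico_subset_Ico_right hb)⟩

/-- A bounded right derivative on `[a, b)` lets a continuous curve be continued to `b`. -/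
theorem exists_continuous_extension {E : Type*} [NormedAddCommGroup E] [NormedSpace ℝ E]
    [FiniteDimensional ℝ E] {w w' : ℝ → E} {a b V : ℝ} (hV : 0 ≤ V)
    (hw : ContinuousOn w (Ico a b))
    (hd : ∀ t ∈ Ico a b, HasDerivWithinAt w (w' t) (Ici t) t) (hb : ∀ t ∈ Ico a b, ‖w' t‖ ≤ V) :
    ∃ W : ℝ → E, Continuous W ∧ EqOn w W (Ico a b) := by
  have key : ∀ s ∈ Ico a b, ∀ t ∈ Ico a b, s ≤ t → dist (w s) (w t) ≤ V * dist s t := by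
    intro s hs t ht hst
    have hsub : Icc s t ⊆ Ico a b := fun u hu => ⟨hs.1.trans hu.1, hu.2.trans_lt ht.2⟩
    have := norm_image_sub_le_of_norm_deriv_right_le_segment (hw.mono hsub)
      (fun u hu => hd u (hsub ⟨hu.1, hu.2.le⟩)) (fun u hu => hb u (hsub ⟨hu.1, hu.2.le⟩)) t
      ⟨hst, le_rfl⟩
    rwa [dist_comm, dist_eq_norm, dist_comm, Real.dist_eq, abs_of_nonneg (sub_nonneg.2 hst)]
  have hlip : LipschitzOnWith ⟨V, hV⟩ w (Ico a b) := by
    refine LipschitzOnWith.of_dist_le_mul fun s hs t ht => ?_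
    rcases le_total s t with h | h
    · exact key s hs t ht h
    · rw [dist_comm, dist_comm s t]
      exact key t ht s hs h
  obtain ⟨W, hW, hEq⟩ := hlip.extend_finite_dimension
  exact ⟨W, hW.continuous, hEq⟩

theorem continuousOn_ite_lt {E : Type*} [TopologicalSpace E] {W w : ℝ → E} (hW : Continuous W)
    (hw : ContinuousOn w (Ico T b)) (hT : w T = W T) :
    ContinuousOn (fun t => if t < T then W t else w t) (Iio b) := by
  intro t ht
  rcases lt_trichotomy t T with hlt | rfl | hgt
  · refine (hW.continuousAt.congr ?_).continuousWithinAt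
    filter_upwards [Iio_mem_nhds hlt] with s hs using (if_pos hs).symm
  · have h1 : ContinuousWithinAt (fun s => if s < t then W s else w s) (Iio t) t := by
      refine hW.continuousWithinAt.congr (fun s hs => if_pos hs) ?_
      rw [if_neg (lt_irrefl t), hT]
    have h2 : ContinuousWithinAt (fun s => if s < t then W s else w s) (Ico t b) t :=
      (hw t ⟨le_rfl, ht⟩).congr (fun s hs => if_neg (not_lt.2 hs.1)) (if_neg (lt_irrefl t))
    refine (h1.union h2).mono fun s hs => ?_
    rcases lt_or_ge s t with h | h
    · exact Or.inl h
    · exact Or.inr ⟨h, hs⟩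
  · have h1 : ContinuousAt w t := (hw t ⟨hgt.le, ht⟩).continuousAt (Ico_mem_nhds hgt ht)
    refine (h1.congr ?_).continuousWithinAt
    filter_upwards [Ioi_mem_nhds hgt] with s hs using (if_neg (not_lt.2 (le_of_lt hs))).symm

theorem IsHoldSolution.ite_lt {Z z : ℝ → EuclideanSpace ℝ (Fin p)}
    {X x : ℝ → EuclideanSpace ℝ (Fin n)} (h : IsHoldSolution q f v T b z x) :
    IsHoldSolution q f v T b (fun t => if t < T then Z t else z t)
      (fun t => if t < T then X t else x t) := by
  have hz : ∀ t, T ≤ t → (if t < T then Z t else z t) = z t := fun t ht => if_neg (not_lt.2 ht)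
  have hx : ∀ t, T ≤ t → (if t < T then X t else x t) = x t := fun t ht => if_neg (not_lt.2 ht)
  refine ⟨h.continuousOn_z.congr fun t ht => hz t ht.1,
    h.continuousOn_x.congr fun t ht => hx t ht.1, fun t ht => ?_, fun t ht => ?_⟩
  · simp only [hz t ht.1, hx t ht.1]
    exact (h.deriv_z t ht).congr (fun s hs => hz s (ht.1.trans hs)) (hz t ht.1)
  · simp only [hz t ht.1, hx t ht.1]
    exact (h.deriv_x t ht).congr (fun s hs => hx s (ht.1.trans hs)) (hx t ht.1)

namespace IsExecution

/-- A bounded execution with finite life time has a limit state, from which it can be continued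
under any constant control. -/
theorem exists_isContinuation (E : IsExecution q f g γbar t₀ T τ z x) (hq : Continuous q)
    (hf : Continuous f) (hg : Continuous g) {M : ℝ}
    (hM : ∀ t : ℝ, t₀ ≤ t → t < T → ‖z t‖ ≤ M ∧ ‖x t‖ ≤ M) :
    ∃ xT, ∀ v, ∃ b, T < b ∧ ∃ z' x', IsContinuation t₀ T b z x z' x' ∧
      IsHoldSolution q f v T b z' x' ∧ x' T = xT := by
  let K : Set (EuclideanSpace ℝ (Fin p) × EuclideanSpace ℝ (Fin n) × EuclideanSpace ℝ (Fin m)) :=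
    Metric.closedBall 0 M ×ˢ Metric.closedBall 0 M ×ˢ (g '' Metric.closedBall 0 M)
  have hK : IsCompact K := (isCompact_closedBall _ _).prod
    ((isCompact_closedBall _ _).prod ((isCompact_closedBall _ _).image hg))
  obtain ⟨V₁, hV₁⟩ := hK.exists_bound_of_continuousOn hq.continuousOn
  obtain ⟨V₂, hV₂⟩ := hK.exists_bound_of_continuousOn hf.continuousOn
  have hset : {t : ℝ | t₀ ≤ t ∧ (t : EReal) < T} = Ico t₀ T := by
    ext t; simp
  have hpiece : ∀ t ∈ Ico t₀ T, ∃ u, (z t, x t, u) ∈ K ∧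
      HasDerivWithinAt z (q (z t, x t, u)) (Ici t) t ∧
      HasDerivWithinAt x (f (z t, x t, u)) (Ici t) t := by
    intro t ht
    have htT := EReal.coe_lt_coe_iff.2 ht.2
    obtain ⟨k, tk, hk, h0k, hkt, htk⟩ := E.exists_piece ht.1 htT
    refine ⟨g (x tk), ⟨?_, ?_, x tk, ?_, rfl⟩, E.deriv_z k tk t hk hkt htk htT,
      E.deriv_x k tk t hk hkt htk htT⟩
    · exact mem_closedBall_zero_iff.2 (hM t ht.1 ht.2).1
    · exact mem_closedBall_zero_iff.2 (hM t ht.1 ht.2).2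
    · exact mem_closedBall_zero_iff.2 (hM tk h0k (hkt.trans_lt ht.2)).2
  choose! u huK huz hux using hpiece
  have h0T : t₀ ∈ Ico t₀ T := ⟨le_rfl, EReal.coe_lt_coe_iff.1 E.start_lt⟩
  obtain ⟨Z, hZ, hzZ⟩ := exists_continuous_extension
    ((norm_nonneg _).trans (hV₁ _ (huK t₀ h0T))) (hset ▸ E.continuousOn_z) huz
    fun t ht => hV₁ _ (huK t ht)
  obtain ⟨X, hX, hxX⟩ := exists_continuous_extension
    ((norm_nonneg _).trans (hV₂ _ (huK t₀ h0T))) (hset ▸ E.continuousOn_x) hux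
    fun t ht => hV₂ _ (huK t ht)
  refine ⟨X T, fun v => ?_⟩
  obtain ⟨δ, hδ, z₁, x₁, hH, hz₁, hx₁⟩ :=
    EventTriggered.exists_isHoldSolution hq hf v T (Z T) (X T)
  refine ⟨T + δ, by linarith, fun t => if t < T then Z t else z₁ t,
    fun t => if t < T then X t else x₁ t, ⟨fun t h0 ht => ?_, fun t h0 ht => ?_, ?_, ?_⟩,
    hH.ite_lt, (if_neg (lt_irrefl T)).trans hx₁⟩
  · have htT := EReal.coe_lt_coe_iff.1 ht
    exact (if_pos htT).trans (hzZ ⟨h0, htT⟩).symm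
  · have htT := EReal.coe_lt_coe_iff.1 ht
    exact (if_pos htT).trans (hxX ⟨h0, htT⟩).symm
  · exact (continuousOn_ite_lt hZ hH.continuousOn_z hz₁).mono fun t ht => ht.2
  · exact (continuousOn_ite_lt hX hH.continuousOn_x hx₁).mono fun t ht => ht.2

/-- A continuation that keeps the control of its last sampling instant, `τ' J ≤ T`, is an
execution. -/
theorem of_isContinuation (E : IsExecution q f g γbar t₀ T τ z x) (hTb : T ≤ b)
    (hc : IsContinuation t₀ T b z x z' x') (h0 : τ' 0 = t₀)
    (hsucc : ∀ k, τ' (k + 1) = nextSample g γbar x' b (τ' k)) {J : ℕ} {sJ : ℝ} (hJ : τ' J = sJ)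
    (hJT : sJ ≤ T) (hJtop : τ' (J + 1) = ⊤) (hH : IsHoldSolution q f (g (x' sJ)) T b z' x') :
    IsExecution q f g γbar t₀ b τ' z' x' := by
  have hTb' : (T : EReal) ≤ b := EReal.coe_le_coe_iff.2 hTb
  have hset : {t : ℝ | t₀ ≤ t ∧ (t : EReal) < b} = Ico t₀ b := by
    ext t; simp
  have hmono : Monotone τ' := monotone_nat_of_le_succ fun k => hsucc k ▸ le_nextSample _
  have hder : ∀ (k : ℕ) (tk t : ℝ), τ' k = tk → tk ≤ t → (t : EReal) < τ' (k + 1) →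
      (t : EReal) < b → HasDerivWithinAt z' (q (z' t, x' t, g (x' tk))) (Ici t) t ∧
      HasDerivWithinAt x' (f (z' t, x' t, g (x' tk))) (Ici t) t := by
    intro k tk t hk hkt ht htb
    rcases lt_or_ge t T with htT | htT
    · exact E.hasDerivWithinAt_of_agree hTb' hc.agree_x h0 hsucc hc.agree_z hk hkt ht
        (EReal.coe_lt_coe_iff.2 htT)
    · have hkJ : k = J := by
        rcases lt_trichotomy k J with h | h | h
        · have := ht.trans_le (hmono h)
          rw [hJ, EReal.coe_lt_coe_iff] at this
          exact absurd this (not_lt.2 (hJT.trans htT))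
        · exact h
        · have := hmono h
          rw [hJtop, hk] at this
          exact absurd (top_le_iff.1 this) (EReal.coe_ne_top _)
      subst hkJ
      obtain rfl : tk = sJ := EReal.coe_injective (hk.symm.trans hJ)
      have htI : t ∈ Ico T b := ⟨htT, EReal.coe_lt_coe_iff.1 htb⟩
      exact ⟨hH.deriv_z t htI, hH.deriv_x t htI⟩
  exact ⟨E.start_lt.trans_le hTb', h0, hsucc, le_top.trans (hJtop ▸ le_iSup τ' (J + 1)),
    hset ▸ hc.continuousOn_z, hset ▸ hc.continuousOn_x,
    fun k tk t h1 h2 h3 h4 => (hder k tk t h1 h2 h3 h4).1,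
    fun k tk t h1 h2 h3 h4 => (hder k tk t h1 h2 h3 h4).2⟩

/-- Continuation with a sampling at time `T`. -/
theorem exists_extension_of_sample (E : IsExecution q f g γbar t₀ T τ z x) {K : ℕ} {tK : ℝ}
    (hK : τ K = tK) (hTb : T < b) (hc : IsContinuation t₀ T b z x z' x')
    (hH : IsHoldSolution q f (g (x' T)) T b z' x')
    (hT : nextSample g γbar x' b tK = T) (hnt : ∀ t ∈ Ioo T b, ¬ Triggered g γbar x' T t) :
    ∃ τ', IsExecution q f g γbar t₀ b τ' z' x' := by
  have hK' : sampleSeq g γbar x' t₀ b K = tK :=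
    (E.sample_eq_of_ne_top (EReal.coe_le_coe_iff.2 hTb.le) hc.agree_x sampleSeq_zero sampleSeq_succ
      K (by rw [hK]; exact EReal.coe_ne_top _)).trans hK
  have hK1 : sampleSeq g γbar x' t₀ b (K + 1) = T := by rw [sampleSeq_succ, hK', hT]
  refine ⟨sampleSeq g γbar x' t₀ b, E.of_isContinuation hTb.le hc sampleSeq_zero sampleSeq_succ
    hK1 le_rfl ?_ hH⟩
  rw [sampleSeq_succ, hK1]
  exact nextSample_eq_top fun t h1 h2 => hnt t ⟨h1, EReal.coe_lt_coe_iff.1 h2⟩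

section LastInterval

variable (E : IsExecution q f g γbar t₀ T τ z x) {K : ℕ} {tK : ℝ} (hK : τ K = tK)
  (hKtop : τ (K + 1) = ⊤)
include E hK hKtop

theorem not_triggered_of_agree (hx : AgreeUntil t₀ T x x') {t : ℝ} (hKt : tK < t) (htT : t < T) :
    ¬ Triggered g γbar x' tK t := by
  have h0 : t₀ ≤ tK := by have := E.start_le K; rwa [hK, EReal.coe_le_coe_iff] at this
  have htT' := EReal.coe_lt_coe_iff.2 htT
  rw [← hx.triggered_iff h0 htT'.le]
  exact E.not_triggered hK hKt (hKtop ▸ EReal.coe_lt_top t) htT'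

/-- Continuation without a further sampling. -/
theorem exists_extension_of_not_triggered (hTb : T < b) (hc : IsContinuation t₀ T b z x z' x')
    (hH : IsHoldSolution q f (g (x' tK)) T b z' x')
    (hnt : ∀ t ∈ Ico T b, ¬ Triggered g γbar x' tK t) :
    ∃ τ', IsExecution q f g γbar t₀ b τ' z' x' := by
  have hKT : tK < T := by
    have := E.lt_of_ne_top (k := K) (by rw [hK]; exact EReal.coe_ne_top _)
    rwa [hK, EReal.coe_lt_coe_iff] at this
  have hK' : sampleSeq g γbar x' t₀ b K = tK :=
    (E.sample_eq_of_ne_top (EReal.coe_le_coe_iff.2 hTb.le) hc.agree_x sampleSeq_zero sampleSeq_succ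
      K (by rw [hK]; exact EReal.coe_ne_top _)).trans hK
  refine ⟨sampleSeq g γbar x' t₀ b, E.of_isContinuation hTb.le hc sampleSeq_zero sampleSeq_succ
    hK' hKT.le ?_ hH⟩
  rw [sampleSeq_succ, hK']
  refine nextSample_eq_top fun t h1 h2 => ?_
  rcases lt_or_ge t T with htT | htT
  · exact E.not_triggered_of_agree hK hKtop hc.agree_x h1 htT
  · exact hnt t ⟨htT, EReal.coe_lt_coe_iff.1 h2⟩

/-- A bounded execution with finite life time and a last sampling instant can be extended. -/
theorem exists_extension_of_last_sample (hq : Continuous q) (hf : Continuous f)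
    (hg : ContDiff ℝ 1 g) (hγ : IsClassKInf γbar) {C : ℝ}
    (hC : Tendsto (fun s => γbar s / s) (𝓝[>] 0) (𝓝 C)) {M : ℝ}
    (hM : ∀ t : ℝ, t₀ ≤ t → t < T → ‖z t‖ ≤ M ∧ ‖x t‖ ≤ M) :
    ∃ b, T < b ∧ ∃ τ' z' x', IsExecution q f g γbar t₀ b τ' z' x' ∧
      AgreeUntil t₀ T z z' ∧ AgreeUntil t₀ T x x' := by
  have hKne : τ K ≠ ⊤ := by rw [hK]; exact EReal.coe_ne_top _
  have h0K : t₀ ≤ tK := by have := E.start_le K; rwa [hK, EReal.coe_le_coe_iff] at this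
  have hKT : tK < T := by
    have := E.lt_of_ne_top hKne
    rwa [hK, EReal.coe_lt_coe_iff] at this
  obtain ⟨xT, hcont⟩ := E.exists_isContinuation hq hf hg.continuous hM
  -- First keep the control `g (x tK)`.
  obtain ⟨b, hTb, z', x', hc, hH, hxT⟩ := hcont (g (x tK))
  have hxK : x' tK = x tK := hc.agree_x tK h0K (EReal.coe_lt_coe_iff.2 hKT)
  rw [← hxK] at hH
  have hle : ∀ {y : ℝ → EuclideanSpace ℝ (Fin n)} {c : ℝ}, AgreeUntil t₀ T x y →
      (T : EReal) ≤ nextSample g γbar y c tK := fun hy =>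
    le_nextSample_of_forall fun t h1 _ h3 =>
      E.not_triggered_of_agree hK hKtop hy h1 (EReal.coe_lt_coe_iff.1 h3)
  by_cases hT : Triggered g γbar x' tK T
  · -- The condition holds at `T`: sample there and continue with the control `g (x T)`.
    obtain ⟨b₁, hTb₁, z₁, x₁, hc₁, hH₁, hx₁⟩ := hcont (g xT)
    rw [← hx₁] at hH₁
    obtain ⟨b₂, hb₂, hnt⟩ := hH₁.exists_forall_not_triggered hf hg hγ hC hTb₁
    have hT₁ : Triggered g γbar x₁ tK T :=
      (hc₁.agree_x.triggered_iff h0K le_rfl).1 ((hc.agree_x.triggered_iff h0K le_rfl).2 hT)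
    obtain ⟨τ', hE'⟩ := E.exists_extension_of_sample hK hb₂.1 (hc₁.mono hb₂.2)
      (hH₁.mono le_rfl hb₂.2)
      (le_antisymm (nextSample_le hKT (EReal.coe_lt_coe_iff.2 hb₂.1) hT₁) (hle hc₁.agree_x)) hnt
    exact ⟨b₂, hb₂.1, τ', z₁, x₁, hE', hc₁.agree_z, hc₁.agree_x⟩
  -- The whole piece from the last sampling instant on.
  have hHK : IsHoldSolution q f (g (x' tK)) tK b z' x' := by
    have hold := E.isHoldSolution (b := T) hK (hKtop ▸ le_top) le_rfl
    have hder : ∀ t ∈ Ico tK b, HasDerivWithinAt z' (q (z' t, x' t, g (x' tK))) (Ici t) t ∧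
        HasDerivWithinAt x' (f (z' t, x' t, g (x' tK))) (Ici t) t := by
      intro t ht
      rcases lt_or_ge t T with htT | htT
      · have h0t := h0K.trans ht.1
        have htT' := EReal.coe_lt_coe_iff.2 htT
        rw [hc.agree_z t h0t htT', hc.agree_x t h0t htT', hxK]
        exact ⟨(hold.deriv_z t ⟨ht.1, htT⟩).congr_of_eventuallyEq
            (hc.agree_z.eventuallyEq h0t htT') (hc.agree_z t h0t htT'),
          (hold.deriv_x t ⟨ht.1, htT⟩).congr_of_eventuallyEq
            (hc.agree_x.eventuallyEq h0t htT') (hc.agree_x t h0t htT')⟩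
      · exact ⟨hH.deriv_z t ⟨htT, ht.2⟩, hH.deriv_x t ⟨htT, ht.2⟩⟩
    exact ⟨hc.continuousOn_z.mono (Ico_subset_Ico_left h0K),
      hc.continuousOn_x.mono (Ico_subset_Ico_left h0K), fun t ht => (hder t ht).1,
      fun t ht => (hder t ht).2⟩
  have hTmem : T ∈ Ico tK b := ⟨hKT.le, hTb⟩
  -- It suffices to find a time before which no triggering occurs.
  have hdone : ∀ c ∈ Ioc T b, (∀ t ∈ Ico T c, ¬ Triggered g γbar x' tK t) →
      ∃ b, T < b ∧ ∃ τ' z' x', IsExecution q f g γbar t₀ b τ' z' x' ∧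
        AgreeUntil t₀ T z z' ∧ AgreeUntil t₀ T x x' := fun c hcb hnt =>
    let ⟨τ', hE'⟩ := E.exists_extension_of_not_triggered hK hKtop hcb.1 (hc.mono hcb.2)
      (hH.mono le_rfl hcb.2) hnt
    ⟨c, hcb.1, τ', z', x', hE', hc.agree_z, hc.agree_x⟩
  by_cases hρ : supNorm (auxInput g x' tK) tK T = 0
  · -- The auxiliary input vanishes up to `T`, so a sampling at `T` does not change the control.
    have hgT : g (x' T) = g (x' tK) := by
      have h1 := ContinuousOn.le_supNorm ((hHK.continuousOn_auxInput hf hg).mono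
        fun σ (hσ : σ ∈ Icc tK T) => ⟨hσ.1, hσ.2.trans_lt hTb⟩) ⟨hKT.le, le_rfl⟩
      rw [hρ, hHK.auxInput_eq hf hg hTmem] at h1
      exact sub_eq_zero.1 (norm_le_zero_iff.1 h1)
    have hHT : IsHoldSolution q f (g (x' T)) T b z' x' := by rwa [hgT]
    obtain ⟨b', hb', hnt⟩ := hHT.exists_forall_not_triggered hf hg hγ hC hTb
    rcases (hle (c := b') hc.agree_x).eq_or_lt with heq | hlt
    · obtain ⟨τ', hE'⟩ := E.exists_extension_of_sample hK hb'.1 (hc.mono hb'.2)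
        (hHT.mono le_rfl hb'.2) heq.symm hnt
      exact ⟨b', hb'.1, τ', z', x', hE', hc.agree_z, hc.agree_x⟩
    · obtain ⟨c, h1, h2⟩ := EReal.lt_iff_exists_real_btwn.1
        (lt_min hlt (EReal.coe_lt_coe_iff.2 hb'.1))
      have hcb' : c < b' := EReal.coe_lt_coe_iff.1 (h2.trans_le (min_le_right _ _))
      refine hdone c ⟨EReal.coe_lt_coe_iff.1 h1, hcb'.le.trans hb'.2⟩ fun t ht htr => ?_
      have h3 := nextSample_le (T := (b' : EReal)) (hKT.trans_le ht.1)
        (EReal.coe_lt_coe_iff.2 (ht.2.trans hcb')) htr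
      exact absurd ((h2.trans_le (min_le_left _ _)).trans_le h3)
        (not_lt.2 (EReal.coe_le_coe_iff.2 ht.2.le))
  · obtain ⟨c, hcb, hnt⟩ := hHK.exists_forall_not_triggered_of_ne_zero hf hg hγ hTmem hT hρ
    exact hdone c hcb hnt

end LastInterval

/-- Positive dwell time on a finite life span leaves finitely many sampling instants. -/
theorem exists_last_sample (E : IsExecution q f g γbar t₀ T τ z x) {h : ℝ} (hh : 0 < h)
    (hdwell : ∀ k, τ k + (h : EReal) ≤ τ (k + 1)) :
    ∃ (K : ℕ) (tK : ℝ), τ K = tK ∧ τ (K + 1) = ⊤ := by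
  classical
  have hlow : ∀ k : ℕ, ((t₀ + k * h : ℝ) : EReal) ≤ τ k := by
    intro k
    induction k with
    | zero => simp [E.sample_zero]
    | succ k ih =>
      have hstep : ((t₀ + (k + 1 : ℕ) * h : ℝ) : EReal) = ((t₀ + k * h : ℝ) : EReal) + h := by
        rw [← EReal.coe_add]
        congr 1
        push_cast
        ring
      rw [hstep]
      exact (add_le_add ih le_rfl).trans (hdwell k)
  have hex : ∃ k, τ k = ⊤ := by
    obtain ⟨N, hN⟩ := exists_nat_gt ((T - t₀) / h)
    rw [div_lt_iff₀ hh] at hN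
    refine ⟨N, ?_⟩
    by_contra hne
    have h1 := (hlow N).trans_lt (E.lt_of_ne_top hne)
    rw [EReal.coe_lt_coe_iff] at h1
    linarith
  have hspec := Nat.find_spec hex
  cases hk : Nat.find hex with
  | zero =>
    rw [hk, E.sample_zero] at hspec
    exact absurd hspec (EReal.coe_ne_top _)
  | succ K =>
    rw [hk] at hspec
    obtain ⟨tK, htK, -⟩ := E.exists_real (Nat.find_min hex (m := K) (by omega))
    exact ⟨K, tK, htK, hspec⟩

end IsExecution

/-- Maximal executions never stop. -/
theorem IsMaximalExecution.eq_top {βz βx : ℝ → ℝ → ℝ} {γzx γzr γxz γxr γξz γξx γξr : ℝ → ℝ}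
    {C : ℝ} {T : EReal} (hE : IsMaximalExecution q f g γbar t₀ T τ z x)
    (A : StandingAssumptions q f g βz βx γzx γzr γxz γxr γξz γξx γξr γbar C) : T = ⊤ := by
  obtain ⟨E, hmax⟩ := hE
  by_contra hne
  lift T to ℝ using ⟨hne, (bot_le.trans_lt E.start_lt).ne'⟩
  obtain ⟨M, hM0, hM⟩ := E.exists_bound A
  obtain ⟨h, hh, hdwell⟩ := E.exists_dwell_time A.hγbar A.lim hM0
    fun t h0 ht => (hM t h0.le ht).2.2.2 h0
  obtain ⟨K, tK, hK, hKtop⟩ := E.exists_last_sample hh hdwell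
  obtain ⟨b, hTb, τ', z', x', hE', hz, hx⟩ := E.exists_extension_of_last_sample hK hKtop A.hq A.hf
    A.hg A.hγbar A.lim fun t h0 ht =>
      have := hM t h0 (EReal.coe_lt_coe_iff.2 ht)
      ⟨this.2.1, this.2.2.1⟩
  have := hmax b τ' z' x' hE' fun t h0 ht => ⟨hz t h0 ht, hx t h0 ht⟩
  exact absurd hTb (not_lt.2 (EReal.coe_le_coe_iff.1 this))

end Continuation

section Stability

variable {p n m : ℕ}
  {q : EuclideanSpace ℝ (Fin p) × EuclideanSpace ℝ (Fin n) × EuclideanSpace ℝ (Fin m) →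
    EuclideanSpace ℝ (Fin p)}
  {f : EuclideanSpace ℝ (Fin p) × EuclideanSpace ℝ (Fin n) × EuclideanSpace ℝ (Fin m) →
    EuclideanSpace ℝ (Fin n)}
  {g : EuclideanSpace ℝ (Fin n) → EuclideanSpace ℝ (Fin m)}
  {βz βx : ℝ → ℝ → ℝ} {γzx γzr γxz γxr γξz γξx γξr : ℝ → ℝ}
  {z : ℝ → EuclideanSpace ℝ (Fin p)} {x : ℝ → EuclideanSpace ℝ (Fin n)}
  {γbar : ℝ → ℝ} {C t₀ : ℝ} {T : EReal} {τ : ℕ → EReal}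

/-! ### Stability -/

theorem StandingAssumptions.stable
    (A : StandingAssumptions q f g βz βx γzx γzr γxz γxr γξz γξx γξr γbar C) {η : ℝ}
    (hη : 0 < η) :
    ∃ δ > 0, ∀ t₀ T τ z x, IsExecution q f g γbar t₀ T τ z x → ‖(z t₀, x t₀)‖ ≤ δ →
      ∀ t : ℝ, t₀ ≤ t → (t : EReal) < T → ‖(z t, x t)‖ ≤ η := by
  obtain ⟨R₁, hR₁, hR₁z⟩ := barGainZ_exists_le A.hγzx A.hγzr A.hγxr hη
  obtain ⟨R₂, hR₂, hR₂x⟩ := barGainZ_exists_le A.hγxz A.hγxr A.hγzr hη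
  have hR : 0 < min R₁ R₂ := lt_min hR₁ hR₂
  have hc := A.hγbar.pos hR
  obtain ⟨e₁, he₁, hz₁⟩ := A.hγξz.exists_le hc
  obtain ⟨e₂, he₂, hx₂⟩ := A.hγξx.exists_le hc
  obtain ⟨e, he, hee₁, hee₂, heη⟩ : ∃ e > 0, e ≤ e₁ ∧ e ≤ e₂ ∧ e ≤ η :=
    ⟨min e₁ (min e₂ η), lt_min he₁ (lt_min he₂ hη), min_le_left _ _,
      (min_le_right _ _).trans (min_le_left _ _), (min_le_right _ _).trans (min_le_right _ _)⟩
  obtain ⟨d₁, hd₁, H₁⟩ := A.hγzx.exists_le he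
  obtain ⟨d₂, hd₂, H₂⟩ := A.hγxz.exists_le he
  obtain ⟨δ₁, hδ₁, D₁⟩ := (A.hβz.classK 0 le_rfl).exists_le (lt_min he hd₂)
  obtain ⟨δ₂, hδ₂, D₂⟩ := (A.hβx.classK 0 le_rfl).exists_le (lt_min he hd₁)
  refine ⟨min δ₁ δ₂, lt_min hδ₁ hδ₂, fun t₀ T τ z x E h t h0 htT => ?_⟩
  have hβz0 := A.hβz.nonneg (norm_nonneg (z t₀)) le_rfl
  have hβx0 := A.hβx.nonneg (norm_nonneg (x t₀)) le_rfl
  have hβz := D₁ ‖z t₀‖ (norm_nonneg _)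
    ((norm_fst_le (z t₀, x t₀)).trans (h.trans (min_le_left _ _)))
  have hβx := D₂ ‖x t₀‖ (norm_nonneg _)
    ((norm_snd_le (z t₀, x t₀)).trans (h.trans (min_le_right _ _)))
  obtain ⟨bz, hbz⟩ : ∃ b, b = max (βz ‖z t₀‖ 0) (γzx (βx ‖x t₀‖ 0)) := ⟨_, rfl⟩
  obtain ⟨bx, hbx⟩ : ∃ b, b = max (βx ‖x t₀‖ 0) (γxz (βz ‖z t₀‖ 0)) := ⟨_, rfl⟩
  have hbz0 : 0 ≤ bz := hbz ▸ le_max_of_le_left hβz0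
  have hbx0 : 0 ≤ bx := hbx ▸ le_max_of_le_left hβx0
  have hbze : bz ≤ e := hbz ▸ max_le (hβz.trans (min_le_left _ _))
    (H₁ _ hβx0 (hβx.trans (min_le_right _ _)))
  have hbxe : bx ≤ e := hbx ▸ max_le (hβx.trans (min_le_left _ _))
    (H₂ _ hβz0 (hβz.trans (min_le_right _ _)))
  obtain ⟨R, hR0, hReq⟩ := A.hγbar.exists_eq (le_max_of_le_left (A.hγξz.nonneg hbz0) :
    0 ≤ max (γξz bz) (γξx bx))
  have hRle : R ≤ min R₁ R₂ := A.hγbar.le_of_le hR0 hR.le (hReq ▸ max_le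
    (hz₁ _ hbz0 (hbze.trans hee₁)) (hx₂ _ hbx0 (hbxe.trans hee₂)))
  obtain ⟨-, h2, h3, -⟩ := E.a_priori A hbz hbx hR0 hReq h0 htT
  exact norm_prod_le_iff.2 ⟨h2.trans (max_le (hbze.trans heη)
    (hR₁z R hR0 (hRle.trans (min_le_left _ _)))), h3.trans (max_le (hbxe.trans heη)
    (hR₂x R hR0 (hRle.trans (min_le_right _ _))))⟩

/-! ### Attractivity -/

/-- The asymptotic supremum of a bounded signal. -/
theorem exists_asymptotic_sup {E : Type*} [NormedAddCommGroup E] {w : ℝ → E} {M : ℝ}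
    (hM : ∀ᶠ t in atTop, ‖w t‖ ≤ M) :
    ∃ W, 0 ≤ W ∧ (∀ e > 0, ∀ᶠ t in atTop, ‖w t‖ ≤ W + e) ∧
      ∀ c, (∀ᶠ t in atTop, ‖w t‖ ≤ c) → W ≤ c := by
  have hbdd : IsBoundedUnder (· ≤ ·) atTop fun t => ‖w t‖ := ⟨M, hM⟩
  have hcob : IsCoboundedUnder (· ≤ ·) atTop fun t => ‖w t‖ :=
    isCoboundedUnder_le_of_le atTop fun t => norm_nonneg (w t)
  refine ⟨limsup (fun t => ‖w t‖) atTop, ?_, fun e he => ?_, fun c hc => ?_⟩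
  · exact le_limsup_of_frequently_le (Eventually.of_forall fun t => norm_nonneg (w t)).frequently
      hbdd
  · exact (eventually_lt_of_limsup_lt (lt_add_of_pos_right _ he) hbdd).mono fun t h => h.le
  · exact limsup_le_of_le hcob hc

namespace IsExecution

/-- On a sampling interval `(t - t_k) γ̄(‖r(t)‖)` is bounded by the supremum of the sampling error
since `t_k`. -/
theorem mul_gain_samplingError_le (E : IsExecution q f g γbar t₀ T τ z x) (hf : Continuous f)
    (hg : ContDiff ℝ 1 g) (hγ : IsClassKInf γbar) {k : ℕ} {tk t M : ℝ} (hk : τ k = tk)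
    (hkt : tk < t) (ht : (t : EReal) < τ (k + 1)) (htT : (t : EReal) < T) (hM0 : 0 ≤ M)
    (hM : ∀ s ∈ Icc tk t, ‖samplingError g x τ s‖ ≤ M) :
    (t - tk) * γbar ‖samplingError g x τ t‖ ≤ M := by
  obtain ⟨b, htb, -, -, hH⟩ := E.exists_isHoldSolution hk ht htT
  have heq : ∀ s ∈ Icc tk t, samplingError g x τ s = auxInput g x tk s := fun s hs => by
    rw [E.samplingError_eq hk hs.1 ((EReal.coe_le_coe_iff.2 hs.2).trans_lt ht),
      hH.auxInput_eq hf hg ⟨hs.1, hs.2.trans_lt htb⟩]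
  have hρM : supNorm (auxInput g x tk) tk t ≤ M := supNorm_le hM0 fun s hs => heq s hs ▸ hM s hs
  have hrρ : ‖samplingError g x τ t‖ ≤ supNorm (auxInput g x tk) tk t := by
    rw [heq t ⟨hkt.le, le_rfl⟩]
    exact ContinuousOn.le_supNorm ((hH.continuousOn_auxInput hf hg).mono
      fun σ hσ => ⟨hσ.1, hσ.2.trans_lt htb⟩) ⟨hkt.le, le_rfl⟩
  have hpos := sub_pos.2 hkt
  refine (mul_le_mul_of_nonneg_left (hγ.mono (norm_nonneg _) hrρ) hpos.le).trans ?_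
  by_cases h0 : supNorm (auxInput g x tk) tk t = 0
  · rw [h0, hγ.zero, mul_zero]
    exact hM0
  · refine le_trans ?_ hρM
    by_contra! hlt
    exact E.not_triggered hk hkt ht htT ⟨h0, hlt.le⟩

/-- An asymptotic bound `Ξ` for the auxiliary output is an asymptotic bound for `γ̄(‖r‖)`, whether
sampling goes on forever or stops. -/
theorem eventually_gain_samplingError_le (E : IsExecution q f g γbar t₀ ⊤ τ z x)
    (hf : Continuous f) (hg : ContDiff ℝ 1 g) (hγ : IsClassKInf γbar) {Ξ M a : ℝ} (hΞ0 : 0 < Ξ)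
    (hΞ : ∀ t, a < t → ‖auxOutput g x t‖ ≤ Ξ) (hM0 : 0 ≤ M)
    (hM : ∀ t, t₀ ≤ t → ‖samplingError g x τ t‖ ≤ M) :
    ∀ᶠ t in atTop, γbar ‖samplingError g x τ t‖ ≤ Ξ := by
  classical
  by_cases htop : ∃ k, τ k = ⊤
  · -- After the last sampling instant `tK` the factor `t - tK` grows without bound.
    have hspec := Nat.find_spec htop
    cases hk : Nat.find htop with
    | zero =>
      rw [hk, E.sample_zero] at hspec
      exact absurd hspec (EReal.coe_ne_top _)
    | succ K =>
      rw [hk] at hspec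
      obtain ⟨tK, htK, h0K⟩ := E.exists_real (Nat.find_min htop (m := K) (by omega))
      filter_upwards [eventually_gt_atTop tK, eventually_ge_atTop (tK + M / Ξ)] with t h1 h2
      have h3 := E.mul_gain_samplingError_le hf hg hγ htK h1 (hspec ▸ EReal.coe_lt_top t)
        (EReal.coe_lt_top t) hM0 fun s hs => hM s (h0K.trans hs.1)
      have h4 : M ≤ (t - tK) * Ξ := by
        rw [← div_le_iff₀ hΞ0]
        linarith
      exact le_of_mul_le_mul_left (h3.trans h4) (sub_pos.2 h1)
  · -- The sampling instants tend to infinity, hence eventually lie after `a`.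
    obtain ⟨k₀, hk₀⟩ := E.exists_lt_sample (EReal.coe_lt_top a)
    obtain ⟨s₀, hs₀, h0s⟩ := E.exists_real (k := k₀) fun h => htop ⟨k₀, h⟩
    rw [hs₀, EReal.coe_lt_coe_iff] at hk₀
    filter_upwards [eventually_ge_atTop s₀] with t ht
    obtain ⟨k, tk, hk, h0k, hkt, htk⟩ := E.exists_piece (h0s.trans ht) (EReal.coe_lt_top t)
    have hkk : k₀ ≤ k := by
      by_contra! hlt
      have := htk.trans_le (E.monotone hlt)
      rw [hs₀, EReal.coe_lt_coe_iff] at this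
      exact absurd ht (not_le.2 this)
    have hatk : a < tk := by
      have := E.monotone hkk
      rw [hs₀, hk, EReal.coe_le_coe_iff] at this
      exact hk₀.trans_le this
    exact E.gain_samplingError_le hf hg hγ hk hkt htk (EReal.coe_lt_top t) hΞ0.le
      fun σ hσ => hΞ σ (hatk.trans hσ.1)

/-- The asymptotic version of the small-gain argument: the asymptotic suprema of `z`, `x` and of
the sampling error satisfy the gain inequalities without transients, hence vanish. -/
theorem tendsto_zero (E : IsExecution q f g γbar t₀ ⊤ τ z x)
    (A : StandingAssumptions q f g βz βx γzx γzr γxz γxr γξz γξx γξr γbar C) :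
    Tendsto (fun t => (z t, x t)) atTop (𝓝 0) := by
  have hT : ∀ t : ℝ, (t : EReal) < ⊤ := EReal.coe_lt_top
  obtain ⟨M, hM0, hM⟩ := E.exists_bound A
  have hev := eventually_ge_atTop t₀
  obtain ⟨Z, hZ0, hZe, hZc⟩ := exists_asymptotic_sup (w := z)
    (hev.mono fun t h => (hM t h (hT t)).2.1)
  obtain ⟨X, hX0, hXe, hXc⟩ := exists_asymptotic_sup (w := x)
    (hev.mono fun t h => (hM t h (hT t)).2.2.1)
  obtain ⟨R, hR0, hRe, hRc⟩ := exists_asymptotic_sup (w := samplingError g x τ)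
    (hev.mono fun t h => (hM t h (hT t)).1)
  have hstart : ∀ e > 0, ∃ a, t₀ ≤ a ∧ ∀ t, a ≤ t →
      ‖z t‖ ≤ Z + e ∧ ‖x t‖ ≤ X + e ∧ ‖samplingError g x τ t‖ ≤ R + e := by
    intro e he
    obtain ⟨a, ha⟩ := eventually_atTop.1 ((hZe e he).and ((hXe e he).and (hRe e he)))
    exact ⟨max a t₀, le_max_right _ _, fun t ht => ha t ((le_max_left _ _).trans ht)⟩
  have hβ : ∀ {β : ℝ → ℝ → ℝ}, IsClassKL β → ∀ s, 0 ≤ s → ∀ a e : ℝ, 0 < e →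
      ∀ᶠ t in atTop, β s (t - a) ≤ e := fun h s hs a e he =>
    (((h.tendsto_zero s hs).comp (tendsto_atTop_add_const_right atTop (-a) tendsto_id)).eventually
      (gt_mem_nhds he)).mono fun t ht => le_of_lt ht
  have hZ1 : ∀ e > 0, Z ≤ max e (max (γzx (X + e)) (γzr (R + e))) := by
    intro e he
    obtain ⟨a, h0a, ha⟩ := hstart e he
    refine hZc _ ?_
    filter_upwards [eventually_gt_atTop a, hβ A.hβz ‖z a‖ (norm_nonneg _) a e he] with t h1 h2
    exact (E.norm_z_le A h0a h1 (hT t) (fun s hs => (ha s hs.1).2.1)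
      (fun s hs => (ha s hs.1).2.2)).trans (max_le_max h2 le_rfl)
  have hX1 : ∀ e > 0, X ≤ max e (max (γxz (Z + e)) (γxr (R + e))) := by
    intro e he
    obtain ⟨a, h0a, ha⟩ := hstart e he
    refine hXc _ ?_
    filter_upwards [eventually_gt_atTop a, hβ A.hβx ‖x a‖ (norm_nonneg _) a e he] with t h1 h2
    exact (E.norm_x_le A h0a h1 (hT t) (fun s hs => (ha s hs.1).1)
      (fun s hs => (ha s hs.1).2.2)).trans (max_le_max h2 le_rfl)
  have hR1 : ∀ e > 0, γbar R ≤ max (γξz (Z + e)) (max (γξx (X + e)) (γξr (R + e))) := by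
    intro e he
    obtain ⟨a, h0a, ha⟩ := hstart e he
    have hpos : 0 < max (γξz (Z + e)) (max (γξx (X + e)) (γξr (R + e))) :=
      lt_max_of_lt_left (A.hγξz.pos (by linarith))
    have h1 := E.eventually_gain_samplingError_le A.hf A.hg A.hγbar hpos
      (fun t hat => E.norm_auxOutput_le A h0a hat (hT t) (fun s hs => (ha s hs.1).1)
        (fun s hs => (ha s hs.1).2.1) (fun s hs => (ha s hs.1).2.2)) hM0
      fun t h => (hM t h (hT t)).1
    obtain ⟨y, hy0, hy⟩ := A.hγbar.exists_eq hpos.le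
    rw [← hy] at h1 ⊢
    exact A.hγbar.mono hR0 (hRc y (h1.mono fun t ht =>
      A.hγbar.le_of_le (norm_nonneg _) hy0 ht))
  have hid : Tendsto (fun e : ℝ => e) (𝓝[>] 0) (𝓝 0) := tendsto_id.mono_left nhdsWithin_le_nhds
  have hZ2 : Z ≤ max 0 (max (γzx X) (γzr R)) :=
    ge_of_tendsto (hid.max ((A.hγzx.tendsto_add hX0).max (A.hγzr.tendsto_add hR0)))
      (by filter_upwards [self_mem_nhdsWithin] with e he using hZ1 e he)
  have hX2 : X ≤ max 0 (max (γxz Z) (γxr R)) :=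
    ge_of_tendsto (hid.max ((A.hγxz.tendsto_add hZ0).max (A.hγxr.tendsto_add hR0)))
      (by filter_upwards [self_mem_nhdsWithin] with e he using hX1 e he)
  have hR2 : γbar R ≤ max (γξz Z) (max (γξx X) (γξr R)) :=
    ge_of_tendsto ((A.hγξz.tendsto_add hZ0).max
      ((A.hγξx.tendsto_add hX0).max (A.hγξr.tendsto_add hR0)))
      (by filter_upwards [self_mem_nhdsWithin] with e he using hR1 e he)
  have hbgz0 : 0 ≤ barGainZ γzx γzr γxr R := barGainZ_nonneg A.hγzr hR0
  have hbgx0 : 0 ≤ barGainX γxz γxr γzr R := barGainZ_nonneg A.hγxr hR0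
  have hZ3 : Z ≤ barGainZ γzx γzr γxr R := by
    have := small_gain A.hγzx A.small hZ0 le_rfl hZ2 hX2 hX0
    rwa [A.hγzx.zero, max_self, max_eq_right hbgz0] at this
  have hX3 : X ≤ barGainX γxz γxr γzr R := by
    have := small_gain A.hγxz (small_gain_symm A.hγzx A.small) hX0 le_rfl hX2 hZ2 hZ0
    rwa [A.hγxz.zero, max_self, ← barGainX_eq, max_eq_right hbgx0] at this
  have hRzero : R = 0 := by
    have h1 : γbar R ≤ max 0 (compositeGain γzx γzr γxz γxr γξz γξx γξr R) :=
      hR2.trans (le_max_of_le_right (max_le_max (A.hγξz.mono hZ0 hZ3)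
        (max_le_max (A.hγξx.mono hX0 hX3) le_rfl)))
    have h2 := A.gain_le le_rfl hR0 h1
    by_contra hne
    exact absurd (A.hγbar.pos (lt_of_le_of_ne hR0 (Ne.symm hne))) (not_lt.2 h2)
  subst hRzero
  have hZzero : Z = 0 := le_antisymm
    (hZ3.trans (by simp [barGainZ, A.hγzr.zero, A.hγxr.zero, A.hγzx.zero])) hZ0
  have hXzero : X = 0 := le_antisymm
    (hX3.trans (by simp [barGainX, A.hγzr.zero, A.hγxr.zero, A.hγxz.zero])) hX0
  subst hZzero hXzero
  rw [Metric.tendsto_nhds]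
  intro e he
  filter_upwards [hZe (e / 2) (by linarith), hXe (e / 2) (by linarith)] with t h1 h2
  rw [dist_zero_right]
  exact (norm_prod_le_iff.2 ⟨h1, h2⟩).trans_lt (by linarith)

end IsExecution

end Stability

end EventTriggered

open EventTriggered in
theorem theorem2 {p n m : ℕ}
    (q : EuclideanSpace ℝ (Fin p) × EuclideanSpace ℝ (Fin n) × EuclideanSpace ℝ (Fin m) →
      EuclideanSpace ℝ (Fin p))
    (f : EuclideanSpace ℝ (Fin p) × EuclideanSpace ℝ (Fin n) × EuclideanSpace ℝ (Fin m) →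
      EuclideanSpace ℝ (Fin n))
    (g : EuclideanSpace ℝ (Fin n) → EuclideanSpace ℝ (Fin m))
    (hq : Continuous q) (hf : Continuous f) (hg : ContDiff ℝ 1 g)
    (hq0 : q (0, 0, 0) = 0) (hf0 : f (0, 0, 0) = 0)
    (βz βx : ℝ → ℝ → ℝ) (γzx γzr γxz γxr γξz γξx γξr : ℝ → ℝ)
    (hβz : IsClassKL βz) (hβx : IsClassKL βx)
    (hγzx : IsClassKInf γzx) (hγzr : IsClassKInf γzr)
    (hγxz : IsClassKInf γxz) (hγxr : IsClassKInf γxr)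
    (hγξz : IsClassKInf γξz) (hγξx : IsClassKInf γξx) (hγξr : IsClassKInf γξr)
    (hissz : ISSz q f g βz γzx γzr) (hissx : ISSx q f g βx γxz γxr)
    (hbsibo : BSIBO q f g γξz γξx γξr)
    (hsmall : ∀ s > 0, γzx (γxz s) < s)
    (hlim : ∃ L : ℝ,
      Tendsto (fun s => compositeGain γzx γzr γxz γxr γξz γξx γξr s / s) (𝓝[>] 0) (𝓝 L))
    (ε : ℝ) (hε : 1 < ε) (γbar : ℝ → ℝ) (hγbar : IsClassKInf γbar)
    (hdom : ∀ s > 0, ε * compositeGain γzx γzr γxz γxr γξz γξx γξr s ≤ γbar s)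
    (hbarlim : ∃ C : ℝ, 0 < C ∧ Tendsto (fun s => γbar s / s) (𝓝[>] 0) (𝓝 C)) :
    IsComplete q f g γbar ∧ IsGloballyAsymptoticallyStable q f g γbar ∧
      IsZenoFree q f g γbar := by
  obtain ⟨C, -, hC⟩ := hbarlim
  have A : StandingAssumptions q f g βz βx γzx γzr γxz γxr γξz γξx γξr γbar C :=
    ⟨hq, hf, hg, hβz, hβx, hγzx.toIsClassK, hγzr.toIsClassK, hγxz.toIsClassK, hγxr.toIsClassK,
      hγξz.toIsClassK, hγξx.toIsClassK, hγξr.toIsClassK, hissz, hissx, hbsibo, hsmall, hγbar,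
      fun s hs => (lt_mul_of_one_lt_left (compositeGain_pos hγξr.toIsClassK hs) hε).trans_le
        (hdom s hs), hC⟩
  refine ⟨⟨exists_isMaximalExecution hq hf hg hγbar hC, fun t₀ T τ z x hE => hE.eq_top A⟩,
    ⟨fun η hη => ?_, fun t₀ T τ z x hE => ?_⟩, fun t₀ T τ z x hE => ?_⟩
  · obtain ⟨δ, hδ, H⟩ := A.stable hη
    exact ⟨δ, hδ, fun t₀ T τ z x hE => H t₀ T τ z x hE.1⟩
  · obtain rfl := hE.eq_top A
    exact ⟨rfl, hE.1.tendsto_zero A⟩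
  · obtain ⟨M, hM0, hM⟩ := hE.1.exists_bound A
    exact hE.1.exists_dwell_time hγbar hC hM0 fun t h0 ht => (hM t h0.le ht).2.2.2 h0
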